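/- Let $n,d\ge 0$ be integers and let $V=(V_{ij})$ be a $d\times d$ matrix of smooth functions $V_{ij}:\mathbb R^n\to\mathbb R$. Let $L$ be a (possibly unbounded) self-adjoint operator on the real Hilbert space $L^2(\mathbb R^n;\mathbb R^d)$ of the form $L=-\Delta\,\mathrm{Id}+V$, i.e. every $\varphi\in C_c^\infty(\mathbb R^n;\mathbb R^d)$ lies in the domain $D(L)$ and $L\varphi=-\Delta\varphi+V\varphi$ ($\Delta$ acting on each component). Suppose that 1. $L\ge 0$, i.e. $\langle L u,u\rangle\ge 0$ for all $u\in D(L)$; 2. $V_{ij}(x)\le 0$ for all $i\ne j$ and all $x\in\mathbb R^n$; 3. $V$ is irreducible: for every splitting of $\{1,\dots,d\}$ into disjoint nonempty sets $S_1,S_2$ there are $i\in S_1$ and $j\in S_2$ with $V_{ij}(x)<0$ for all $x\in\mathbb R^n$. Let $\xi\in D(L)$ satisfy $L\xi=\eta\in L^2(\mathbb R^n;\mathbb R^d)$, where $\eta\ge 0$ componentwise almost everywhere and $\xi\not\equiv 0$. Then either * $\xi>0$, or * $\eta\equiv 0$ and $\xi<0$. Here $\xi>0$ means that for every component $\xi_i$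 and every compact $K\subset\mathbb R^n$ there is $c>0$ with $\xi_i\ge c$ almost everywhere on $K$ (in particular $\xi_i>0$ almost everywhere, and everywhere if $\xi_i$ is continuous); $\xi<0$ means $-\xi>0$. -/

import Mathlib

open MeasureTheory
open scoped ContDiff Matrix Laplacian

/-- The real Hilbert space `L²(ℝⁿ; ℝᵈ)`. -/
abbrev VecL2 (n d : ℕ) : Type :=
  Lp (EuclideanSpace ℝ (Fin d)) 2 (volume : Measure (EuclideanSpace ℝ (Fin n)))

/-- The differential expression `-Δφ + Vφ`, with `Δ` acting on each component of `φ` and `V` acting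
by matrix multiplication. -/
noncomputable def schrodingerExpr {n d : ℕ}
    (V : EuclideanSpace ℝ (Fin n) → Matrix (Fin d) (Fin d) ℝ)
    (φ : EuclideanSpace ℝ (Fin n) → EuclideanSpace ℝ (Fin d)) :
    EuclideanSpace ℝ (Fin n) → EuclideanSpace ℝ (Fin d) :=
  fun x => -(Δ φ) x + WithLp.toLp 2 (V x *ᵥ (φ x).ofLp)

/-- The (in general unbounded) operator `L` on `L²(ℝⁿ; ℝᵈ)` is of the form `-Δ + V`: every smooth
compactly supported `φ` lies in the domain of `L`, and `Lφ = -Δφ + Vφ`. If `L` is self-adjoint and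
`V` is smooth, it follows by duality that `Lξ = -Δξ + Vξ` in the sense of distributions for every
`ξ` in the domain of `L`. -/
def IsSchrodingerOperator {n d : ℕ} (L : VecL2 n d →ₗ.[ℝ] VecL2 n d)
    (V : EuclideanSpace ℝ (Fin n) → Matrix (Fin d) (Fin d) ℝ) : Prop :=
  ∀ φ : EuclideanSpace ℝ (Fin n) → EuclideanSpace ℝ (Fin d),
    ContDiff ℝ ∞ φ → HasCompactSupport φ →
      ∃ u : L.domain, (⇑(u : VecL2 n d) =ᵐ[volume] φ) ∧ (⇑(L u) =ᵐ[volume] schrodingerExpr V φ)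

/-- Irreducibility of `V`: for any splitting of the index set into two nonempty disjoint sets `S`
and `Sᶜ`, some entry `V i j` with `i ∈ S`, `j ∈ Sᶜ` is negative everywhere. -/
def IrreducibleCoupling {n d : ℕ}
    (V : EuclideanSpace ℝ (Fin n) → Matrix (Fin d) (Fin d) ℝ) : Prop :=
  ∀ S : Set (Fin d), S.Nonempty → Sᶜ.Nonempty → ∃ i ∈ S, ∃ j ∈ Sᶜ, ∀ x, V x i j < 0

/-- Strict componentwise positivity of an a.e.-defined function, in the sense of the strong maximum
principle: each component has a positive essential lower bound on every compact set. This implies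
that every component is positive almost everywhere, and for a continuous `u` it says exactly that
`u x i > 0` for all `x` and all `i`. -/
def StrictlyPos {n d : ℕ} (u : EuclideanSpace ℝ (Fin n) → EuclideanSpace ℝ (Fin d)) : Prop :=
  ∀ i : Fin d, ∀ K : Set (EuclideanSpace ℝ (Fin n)), IsCompact K →
    ∃ c : ℝ, 0 < c ∧ ∀ᵐ x ∂volume.restrict K, c ≤ u x i

/-! The heart of the matter is that the negative part `ξ⁻` solves the homogeneous system in the
sense of distributions (`negPart_weak_solution`). Formally, nonnegativity of the quadratic form of
`L` on `χξ⁻ + tφ`, with `χ` a cutoff of scale `R` and `φ` a test function, gives `0 ≤ ∫|∇χ|²|ξ⁻|² +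
(terms ≤ 0) + 2t⟨ξ⁻, Lφ⟩ + t²⟨Lφ, φ⟩`. The dropped terms are nonpositive because `η ≥ 0` and the
off-diagonal couplings are `≤ 0`. Since `ξ ∈ L²`, the gradient term disappears as `R → ∞`, and since
`t` is arbitrary, `⟨ξ⁻, Lφ⟩ = 0`.

The computation is done without Sobolev regularity of `ξ`. Mollify `ξ` and replace `s ↦ s⁻` by a
smooth convex `softNeg`; convexity gives the second-order term a sign (`sum_integral_energy_le`).
What remains contains `ξ` only through `L²` quantities and `Δξ`, which the equation expresses
through `η` and `ξ`, so local `L²` convergence suffices for the limit (`energy_limit`).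

The second ingredient is a strong maximum principle for nonnegative `L²` distributional
supersolutions (`cooperative_strong_maximum_principle`). For one component, a weighted mean value
inequality for mollifications bounds the function below near a point by its mass there, and
connectedness of `ℝⁿ` makes the alternative "zero or locally bounded below" global. Irreducibility
then forbids that some components vanish and others do not.

Apply this to `ξ⁻`. If `ξ⁻ = 0`, then `ξ ≥ 0` is a nonzero supersolution, hence `ξ > 0`. If `ξ⁻ >
0`, then `ξ = -ξ⁻` solves the homogeneous system, so `η = 0` and `ξ < 0`. -/

/-- The `i`-th partial derivative of a real-valued function on `ℝⁿ`. -/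
noncomputable def pd {n : ℕ} (i : Fin n) (f : EuclideanSpace ℝ (Fin n) → ℝ) :
    EuclideanSpace ℝ (Fin n) → ℝ :=
  fun x => fderiv ℝ f x (EuclideanSpace.single i 1)

/-- The Laplacian of a real-valued function on `ℝⁿ`, in coordinates. -/
noncomputable def lap {n : ℕ} (f : EuclideanSpace ℝ (Fin n) → ℝ) :
    EuclideanSpace ℝ (Fin n) → ℝ :=
  fun x => ∑ i, pd i (pd i f) x

/-- The squared norm of the gradient, in coordinates. -/
noncomputable def gradSq {n : ℕ} (f : EuclideanSpace ℝ (Fin n) → ℝ) :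
    EuclideanSpace ℝ (Fin n) → ℝ :=
  fun x => ∑ i, pd i f x ^ 2

/-! ### Coordinate calculus and integration by parts for smooth functions. -/

section Calculus

variable {n : ℕ} {f g : EuclideanSpace ℝ (Fin n) → ℝ}

theorem ContDiff.pd (hf : ContDiff ℝ ∞ f) (i : Fin n) : ContDiff ℝ ∞ (pd i f) :=
  (hf.fderiv_right (m := ∞) (by simp)).clm_apply contDiff_const

theorem ContDiff.lap (hf : ContDiff ℝ ∞ f) : ContDiff ℝ ∞ (lap f) :=
  ContDiff.sum fun i _ => (hf.pd i).pd i

theorem ContDiff.gradSq (hf : ContDiff ℝ ∞ f) : ContDiff ℝ ∞ (gradSq f) :=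
  ContDiff.sum fun i _ => (hf.pd i).pow 2

theorem tsupport_pd_subset (i : Fin n) : tsupport (pd i f) ⊆ tsupport f :=
  tsupport_fderiv_apply_subset ℝ _

theorem HasCompactSupport.pd (hf : HasCompactSupport f) (i : Fin n) :
    HasCompactSupport (pd i f) :=
  hf.fderiv_apply ℝ _

theorem tsupport_lap_subset : tsupport (lap f) ⊆ tsupport f := by
  refine closure_minimal (fun x hx => ?_) (isClosed_tsupport f)
  by_contra h
  refine hx (Finset.sum_eq_zero fun i _ => ?_)
  exact image_eq_zero_of_notMem_tsupport
    fun h' => h (tsupport_pd_subset i (tsupport_pd_subset i h'))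

theorem HasCompactSupport.lap (hf : HasCompactSupport f) : HasCompactSupport (lap f) :=
  hf.of_isClosed_subset (isClosed_tsupport _) tsupport_lap_subset

theorem hasCompactSupport_gradSq (hc : HasCompactSupport f) : HasCompactSupport (gradSq f) := by
  refine HasCompactSupport.of_support_subset_isCompact hc fun x hx => ?_
  by_contra h
  exact hx (Finset.sum_eq_zero fun i _ => by
    rw [image_eq_zero_of_notMem_tsupport fun h' => h (tsupport_pd_subset i h')]; simp)

theorem ContDiff.differentiableAt_infty (hf : ContDiff ℝ ∞ f) (x) : DifferentiableAt ℝ f x :=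
  hf.contDiffAt.differentiableAt (by simp)

theorem pd_mul (hf : ContDiff ℝ ∞ f) (hg : ContDiff ℝ ∞ g) (i : Fin n) :
    pd i (fun x => f x * g x) = fun x => f x * pd i g x + pd i f x * g x := by
  ext x
  simp only [pd]
  rw [fderiv_fun_mul (hf.differentiableAt_infty x) (hg.differentiableAt_infty x)]
  simp [mul_comm]

theorem pd_comp {h : ℝ → ℝ} (hh : ContDiff ℝ ∞ h) (hf : ContDiff ℝ ∞ f) (i : Fin n) :
    pd i (fun x => h (f x)) = fun x => deriv h (f x) * pd i f x := by
  ext x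
  have h1 : DifferentiableAt ℝ h (f x) := hh.contDiffAt.differentiableAt (by simp)
  have := (h1.hasDerivAt.comp_hasFDerivAt x (hf.differentiableAt_infty x).hasFDerivAt).fderiv
  simp only [pd]
  rw [show (fun x => h (f x)) = h ∘ f from rfl, this]
  simp

theorem lap_comp {h : ℝ → ℝ} (hh : ContDiff ℝ ∞ h) (hf : ContDiff ℝ ∞ f) (x) :
    lap (fun x => h (f x)) x = deriv h (f x) * lap f x + deriv (deriv h) (f x) * gradSq f x := by
  have hd : ContDiff ℝ ∞ (deriv h) := (contDiff_infty_iff_deriv.1 hh).2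
  simp only [lap, gradSq, Finset.mul_sum, ← Finset.sum_add_distrib]
  refine Finset.sum_congr rfl fun i _ => ?_
  rw [pd_comp hh hf, pd_mul (f := fun x => deriv h (f x)) (hd.comp hf) (hf.pd i), pd_comp hd hf]
  ring

/-- Integration by parts on `ℝⁿ` for smooth functions one of which has compact support. -/
theorem integral_mul_pd (hf : ContDiff ℝ ∞ f) (hg : ContDiff ℝ ∞ g) (hc : HasCompactSupport f)
    (i : Fin n) : ∫ x, f x * pd i g x = -∫ x, pd i f x * g x := by
  refine integral_mul_fderiv_eq_neg_fderiv_mul_of_integrable ?_ ?_ ?_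
    (fun x _ => hf.differentiableAt_infty x) (fun x _ => hg.differentiableAt_infty x)
  · exact ((hf.pd i).continuous.mul hg.continuous).integrable_of_hasCompactSupport
      (hc.pd i).mul_right
  · exact (hf.continuous.mul (hg.pd i).continuous).integrable_of_hasCompactSupport hc.mul_right
  · exact (hf.continuous.mul hg.continuous).integrable_of_hasCompactSupport hc.mul_right

theorem integral_mul_lap (hf : ContDiff ℝ ∞ f) (hg : ContDiff ℝ ∞ g) (hc : HasCompactSupport f) :
    ∫ x, f x * lap g x = -∫ x, ∑ i, pd i f x * pd i g x := by
  simp only [lap, Finset.mul_sum]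
  rw [integral_finsetSum, integral_finsetSum, ← Finset.sum_neg_distrib]
  · exact Finset.sum_congr rfl fun i _ => integral_mul_pd hf (hg.pd i) hc i
  · exact fun i _ => ((hf.pd i).continuous.mul (hg.pd i).continuous).integrable_of_hasCompactSupport
      (hc.pd i).mul_right
  · exact fun i _ => (hf.continuous.mul ((hg.pd i).pd i).continuous).integrable_of_hasCompactSupport
      hc.mul_right

/-- The energy of a truncated smooth function. -/
theorem integral_cutoff_mul_neg_lap {χ v : EuclideanSpace ℝ (Fin n) → ℝ} (hχ : ContDiff ℝ ∞ χ)
    (hv : ContDiff ℝ ∞ v) (hc : HasCompactSupport χ) :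
    ∫ x, (χ x * v x) * -lap (fun y => χ y * v y) x =
      ∫ x, (gradSq χ x * v x ^ 2 + χ x ^ 2 * v x * -lap v x) := by
  -- Localisation identity `|∇(χv)|² = v²|∇χ|² + ∇(χ²v)·∇v`. The product `χ²v` is written `χ(χv)` so
  -- that `pd_mul` can be applied twice.
  have h2 : ContDiff ℝ ∞ fun x => χ x * (χ x * v x) := hχ.mul (hχ.mul hv)
  have c2 : HasCompactSupport fun x => χ x * (χ x * v x) := hc.mul_right
  have I1 : ∫ x, (χ x * v x) * -lap (fun y => χ y * v y) x =
      ∫ x, ∑ i, pd i (fun y => χ y * v y) x * pd i (fun y => χ y * v y) x := by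
    simp only [mul_neg, integral_neg]
    rw [integral_mul_lap (hχ.mul hv) (hχ.mul hv) hc.mul_right, neg_neg]
  have I2 : ∫ x, χ x ^ 2 * v x * -lap v x =
      ∫ x, ∑ i, pd i (fun x => χ x * (χ x * v x)) x * pd i v x := by
    rw [← neg_neg (∫ x, ∑ i, pd i (fun x => χ x * (χ x * v x)) x * pd i v x),
      ← integral_mul_lap h2 hv c2, ← integral_neg]
    congr 1; ext x; ring
  rw [I1, integral_add, I2, ← integral_add]
  · congr 1; ext x
    simp only [gradSq, Finset.sum_mul, ← Finset.sum_add_distrib]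
    refine Finset.sum_congr rfl fun i _ => ?_
    rw [pd_mul hχ (hχ.mul hv), pd_mul hχ hv]
    ring
  · refine Continuous.integrable_of_hasCompactSupport
      ((hχ.gradSq.continuous).mul (hv.continuous.pow 2)) (hasCompactSupport_gradSq hc).mul_right
  · refine Continuous.integrable_of_hasCompactSupport (continuous_finsetSum _ fun i _ =>
      (h2.pd i).continuous.mul (hv.pd i).continuous)
      (HasCompactSupport.of_support_subset_isCompact c2 fun x hx => ?_)
    by_contra h
    exact hx (Finset.sum_eq_zero fun i _ => by
      rw [image_eq_zero_of_notMem_tsupport fun h' => h (tsupport_pd_subset i h')]; simp)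
  · refine Continuous.integrable_of_hasCompactSupport
      ((hχ.gradSq.continuous).mul (hv.continuous.pow 2)) (hasCompactSupport_gradSq hc).mul_right
  · refine Continuous.integrable_of_hasCompactSupport
      (((hχ.continuous.pow 2).mul hv.continuous).mul hv.lap.continuous.neg) ?_
    refine HasCompactSupport.mul_right (HasCompactSupport.mul_right ?_)
    simp only [sq]
    exact hc.mul_right

/-- The Laplacian acts componentwise. -/
theorem laplacian_apply_eq_lap {d : ℕ}
    {φ : EuclideanSpace ℝ (Fin n) → EuclideanSpace ℝ (Fin d)} (hφ : ContDiff ℝ ∞ φ) (x)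
    (j : Fin d) : (Δ φ) x j = lap (fun y => φ y j) x := by
  have h1 := (hφ.contDiffAt (x := x)).of_le (m := 2) (by norm_cast)
  have h2 := h1.laplacian_CLM_comp_left (l := EuclideanSpace.proj (𝕜 := ℝ) j)
  have h3 : (EuclideanSpace.proj (𝕜 := ℝ) j ∘ φ) = fun y => φ y j := rfl
  have hs : ContDiff ℝ ∞ fun y => φ y j := (EuclideanSpace.proj (𝕜 := ℝ) j).contDiff.comp hφ
  change (EuclideanSpace.proj (𝕜 := ℝ) j ∘ (Δ φ)) x = _
  rw [← h2, h3,
    InnerProductSpace.laplacian_eq_iteratedFDeriv_orthonormalBasis _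
      (EuclideanSpace.basisFun (Fin n) ℝ)]
  simp only [lap, iteratedFDeriv_two_apply]
  refine Finset.sum_congr rfl fun i _ => ?_
  have hd : DifferentiableAt ℝ (fderiv ℝ fun y => φ y j) x :=
    ((hs.fderiv_right (m := ∞) (by simp)).contDiffAt).differentiableAt (by simp)
  have h5 := fderiv_clm_apply hd (differentiableAt_const (EuclideanSpace.single i (1 : ℝ)))
  simp only [EuclideanSpace.basisFun_apply, Matrix.cons_val_zero, Matrix.cons_val_one]
  unfold pd
  rw [h5]
  simp

theorem lap_zero : lap (fun _ : EuclideanSpace ℝ (Fin n) => (0 : ℝ)) = 0 := by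
  ext x
  have h : ∀ i, pd i (fun _ : EuclideanSpace ℝ (Fin n) => (0 : ℝ)) = fun _ => 0 := by
    intro i; ext y; simp [pd]
  simp [lap, h]

theorem gradSq_nonneg (x) : 0 ≤ gradSq f x := Finset.sum_nonneg fun _ _ => sq_nonneg _

theorem pd_comp_add_smul (hf : ContDiff ℝ ∞ f) (c : ℝ) (a : EuclideanSpace ℝ (Fin n))
    (i : Fin n) : pd i (fun x => f (a + c • x)) = fun x => c * pd i f (a + c • x) := by
  ext x
  have h1 : HasFDerivAt (fun x : EuclideanSpace ℝ (Fin n) => a + c • x)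
      (c • ContinuousLinearMap.id ℝ _) x := ((hasFDerivAt_id x).const_smul c).const_add a
  have := ((hf.differentiableAt_infty (a + c • x)).hasFDerivAt.comp x h1).fderiv
  simp only [pd]
  rw [show (fun x => f (a + c • x)) = f ∘ fun x => a + c • x from rfl, this]
  simp

end Calculus

/-! ### A smooth convex replacement for the negative part. -/

section SoftNeg

/-- A smooth, positive, convex approximation of the negative part. -/
noncomputable def softNeg (δ s : ℝ) : ℝ := (√(s ^ 2 + δ ^ 2) - s) / 2

variable {δ : ℝ}

theorem contDiff_softNeg (hδ : 0 < δ) : ContDiff ℝ ∞ (softNeg δ) :=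
  ((((contDiff_id.pow 2).add contDiff_const).sqrt fun s => by positivity).sub contDiff_id).div_const 2

theorem abs_lt_sqrt_sq_add_sq (hδ : 0 < δ) (s : ℝ) : |s| < √(s ^ 2 + δ ^ 2) := by
  rw [← Real.sqrt_sq_eq_abs]
  exact Real.sqrt_lt_sqrt (sq_nonneg s) (by nlinarith [sq_pos_of_pos hδ])

theorem softNeg_pos (hδ : 0 < δ) (s : ℝ) : 0 < softNeg δ s := by
  have := (abs_lt_sqrt_sq_add_sq hδ s)
  have := le_abs_self s
  unfold softNeg; linarith

theorem deriv_softNeg (hδ : 0 < δ) :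
    deriv (softNeg δ) = fun s => -(softNeg δ s / √(s ^ 2 + δ ^ 2)) := by
  ext s
  have h0 : s ^ 2 + δ ^ 2 ≠ 0 := by positivity
  have h1 : 0 < √(s ^ 2 + δ ^ 2) := by positivity
  have h : HasDerivAt (softNeg δ) ((2 * s / (2 * √(s ^ 2 + δ ^ 2)) - 1) / 2) s := by
    refine (((((hasDerivAt_pow 2 s).add_const (δ ^ 2)).sqrt h0).sub
      (hasDerivAt_id' s)).div_const 2).congr_deriv ?_
    norm_num
  rw [h.deriv, softNeg]
  field_simp
  ring

/-- The second derivative is `δ² / (2(s² + δ²)^{3/2})`. Its sign allows the `|∇w|²` term in the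
Laplacian of `softNeg δ ∘ w` to be discarded. -/
theorem deriv_deriv_softNeg_nonneg (hδ : 0 < δ) (s : ℝ) : 0 ≤ deriv (deriv (softNeg δ)) s := by
  have h0 : s ^ 2 + δ ^ 2 ≠ 0 := by positivity
  have h1 : 0 < √(s ^ 2 + δ ^ 2) := by positivity
  have h2 : √(s ^ 2 + δ ^ 2) ^ 2 = s ^ 2 + δ ^ 2 := Real.sq_sqrt (by positivity)
  have hs : HasDerivAt (fun s => √(s ^ 2 + δ ^ 2)) (s / √(s ^ 2 + δ ^ 2)) s := by
    convert ((hasDerivAt_pow 2 s).add_const (δ ^ 2)).sqrt h0 using 1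
    simp; field_simp
  have h : HasDerivAt (deriv (softNeg δ)) (δ ^ 2 / (2 * √(s ^ 2 + δ ^ 2) ^ 3)) s := by
    have e : deriv (softNeg δ) = fun s => (s / √(s ^ 2 + δ ^ 2) - 1) / 2 := by
      rw [deriv_softNeg hδ]
      ext s
      have h1 : 0 < √(s ^ 2 + δ ^ 2) := by positivity
      unfold softNeg
      field_simp
      ring
    rw [e]
    refine ((((hasDerivAt_id' s).div hs h1.ne').sub_const 1).div_const 2).congr_deriv ?_
    field_simp
    rw [h2]; ring
  rw [h.deriv]; positivity

theorem abs_softNeg_sub_negPart_le (hδ : 0 < δ) (s : ℝ) : |softNeg δ s - max (-s) 0| ≤ δ := by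
  have h1 := abs_lt_sqrt_sq_add_sq hδ s
  have h3 : √(s ^ 2 + δ ^ 2) ≤ |s| + δ :=
    Real.sqrt_le_iff.2 ⟨by positivity, by nlinarith [sq_abs s, abs_nonneg s]⟩
  unfold softNeg
  rw [abs_le]
  rcases le_total 0 s with h | h
  · rw [max_eq_right (by linarith)]; rw [abs_of_nonneg h] at *; constructor <;> linarith
  · rw [max_eq_left (by linarith)]; rw [abs_of_nonpos h] at *; constructor <;> linarith

/-- This product is the factor multiplying `Δw` in the energy. With `r = √(s² + δ²)` it equals `(r -
s)²/(4r)`, and its distance to the negative part is `(r - |s|)²/(4r)`, where `r - |s| ≤ δ ≤ r`. -/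
theorem abs_neg_softNeg_mul_deriv_sub_negPart_le (hδ : 0 < δ) (s : ℝ) :
    |-(softNeg δ s * deriv (softNeg δ) s) - max (-s) 0| ≤ δ := by
  have h1 := abs_lt_sqrt_sq_add_sq hδ s
  have hr : 0 < √(s ^ 2 + δ ^ 2) := by positivity
  have h2 : √(s ^ 2 + δ ^ 2) ^ 2 = s ^ 2 + δ ^ 2 := Real.sq_sqrt (by positivity)
  have h3 : √(s ^ 2 + δ ^ 2) ≤ |s| + δ :=
    Real.sqrt_le_iff.2 ⟨by positivity, by nlinarith [sq_abs s, abs_nonneg s]⟩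
  rw [deriv_softNeg hδ]
  beta_reduce
  set r := √(s ^ 2 + δ ^ 2) with hrdef
  have e : -(softNeg δ s * -(softNeg δ s / r)) = (r - s) ^ 2 / (4 * r) := by
    simp only [softNeg, ← hrdef]; field_simp; ring
  rw [e]
  have hd : δ ≤ r := Real.le_sqrt_of_sq_le (by nlinarith [sq_nonneg s])
  rcases le_total 0 s with h | h
  · rw [max_eq_right (by linarith), sub_zero, abs_of_nonneg (by positivity),
      div_le_iff₀ (by positivity)]
    rw [abs_of_nonneg h] at *
    nlinarith
  · rw [max_eq_left (by linarith)]
    have : (r - s) ^ 2 / (4 * r) - -s = (r + s) ^ 2 / (4 * r) := by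
      field_simp; ring
    rw [abs_of_nonpos h] at *
    rw [this, abs_of_nonneg (by positivity), div_le_iff₀ (by positivity)]
    nlinarith

end SoftNeg

/-! ### Mollification in `L²`. -/

section Mollify

open Filter Topology Convolution
open scoped ENNReal

variable {n : ℕ}

/-- A standard approximate identity on `ℝⁿ`; the `k`-th kernel is supported in the ball of radius
`1 / (k + 1)`. -/
noncomputable def mollifier (n k : ℕ) : EuclideanSpace ℝ (Fin n) → ℝ :=
  (⟨1 / (k + 2), 1 / (k + 1), by positivity, by gcongr; norm_num⟩ :
    ContDiffBump (0 : EuclideanSpace ℝ (Fin n))).normed volume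

theorem contDiff_mollifier (k : ℕ) : ContDiff ℝ ∞ (mollifier n k) := ContDiffBump.contDiff_normed _

theorem hasCompactSupport_mollifier (k : ℕ) : HasCompactSupport (mollifier n k) :=
  ContDiffBump.hasCompactSupport_normed _

theorem mollifier_nonneg (k : ℕ) (x) : 0 ≤ mollifier n k x := ContDiffBump.nonneg_normed _ _

theorem integral_mollifier (k : ℕ) : ∫ x, mollifier n k x = 1 := ContDiffBump.integral_normed _

theorem tsupport_mollifier (k : ℕ) :
    tsupport (mollifier n k) = Metric.closedBall 0 (1 / (k + 1)) :=
  ContDiffBump.tsupport_normed_eq _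

/-- Convolution of a real-valued function with a real-valued kernel. -/
noncomputable def smear (ρ u : EuclideanSpace ℝ (Fin n) → ℝ) : EuclideanSpace ℝ (Fin n) → ℝ :=
  fun x => ∫ y, ρ (x - y) * u y

theorem smear_eq_convolution (ρ u : EuclideanSpace ℝ (Fin n) → ℝ) :
    smear ρ u = ρ ⋆[ContinuousLinearMap.lsmul ℝ ℝ, volume] u := by
  ext x
  rw [convolution_eq_swap]
  rfl

variable {ρ u : EuclideanSpace ℝ (Fin n) → ℝ}

theorem smear_apply_swap (x) : smear ρ u x = ∫ t, ρ t * u (x - t) := by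
  rw [smear_eq_convolution]; rfl

theorem ContDiff.smear (hρ : ContDiff ℝ ∞ ρ) (hc : HasCompactSupport ρ)
    (hu : LocallyIntegrable u) : ContDiff ℝ ∞ (smear ρ u) := by
  rw [smear_eq_convolution]
  exact hc.contDiff_convolution_left _ hρ hu

theorem pd_smear (hρ : ContDiff ℝ ∞ ρ) (hc : HasCompactSupport ρ)
    (hu : LocallyIntegrable u) (i : Fin n) : pd i (smear ρ u) = smear (pd i ρ) u := by
  ext x
  have h1 : ContDiff ℝ 1 ρ := hρ.of_le (by norm_cast)
  have := (hc.hasFDerivAt_convolution_left (ContinuousLinearMap.lsmul ℝ ℝ) h1 hu x).fderiv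
  rw [pd, smear_eq_convolution, this, smear_apply_swap, convolution_def,
    ContinuousLinearMap.integral_apply]
  · rfl
  · exact HasCompactSupport.convolutionExists_left _ (hc.fderiv ℝ)
      (h1.continuous_fderiv (by simp)) hu x

theorem lap_smear (hρ : ContDiff ℝ ∞ ρ) (hc : HasCompactSupport ρ)
    (hu : LocallyIntegrable u) : lap (smear ρ u) = smear (lap ρ) u := by
  ext x
  have h : ∀ i, pd i (pd i (smear ρ u)) x = ∫ y, pd i (pd i ρ) (x - y) * u y := fun i => by
    rw [pd_smear hρ hc hu, pd_smear (hρ.pd i) (hc.pd i) hu]; rfl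
  simp only [lap, h, smear, Finset.sum_mul]
  rw [integral_finsetSum]
  intro i _
  have := (HasCompactSupport.convolutionExists_left (ContinuousLinearMap.lsmul ℝ ℝ)
    ((hc.pd i).pd i) ((hρ.pd i).pd i).continuous hu x).integrable_swap
  exact this

theorem integrable_smear_integrand (hρ : Continuous ρ) (hc : HasCompactSupport ρ)
    (hu : LocallyIntegrable u) (x) : Integrable fun t => ρ t * u (x - t) :=
  HasCompactSupport.convolutionExists_left (ContinuousLinearMap.lsmul ℝ ℝ) hc hρ hu x

/-- Translations act continuously on `L²`; the action of `-t` is `x ↦ u (-t + x)`. -/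
theorem tendsto_eLpNorm_translate_sub (hu : MemLp u 2) :
    Tendsto (fun t => eLpNorm (fun x => u (x - t) - u x) 2) (𝓝 0) (𝓝 0) := by
  have : Fact ((2 : ℝ≥0∞) ≠ ⊤) := ⟨by simp⟩
  have hcont : Continuous fun t : EuclideanSpace ℝ (Fin n) =>
      DomAddAct.mk (-t) +ᵥ hu.toLp u :=
    (continuous_vadd (M := (EuclideanSpace ℝ (Fin n))ᵈᵃᵃ)).comp
      ((DomAddAct.continuous_mk.comp continuous_neg).prodMk continuous_const)
  have h := hcont.tendsto 0
  have h0 : DomAddAct.mk (-(0 : EuclideanSpace ℝ (Fin n))) +ᵥ hu.toLp u = hu.toLp u := by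
    simp
  rw [h0, Lp.tendsto_Lp_iff_tendsto_eLpNorm _ _ hu] at h
  refine h.congr fun t => eLpNorm_congr_ae ?_
  rw [DomAddAct.mk_vadd_toLp]
  filter_upwards [MemLp.coeFn_toLp
    (hu.comp_measurePreserving (measurePreserving_vadd (-t) volume))] with x hx
  refine congrArg (· - u x) (hx.trans ?_)
  simp [sub_eq_neg_add]

/-- Jensen's inequality for the probability density `ρ`, obtained from Cauchy–Schwarz after
splitting `ρ = ρ^{1/2} ρ^{1/2}`. -/
theorem enorm_smear_sub_sq_le (hρ : Continuous ρ) (hc : HasCompactSupport ρ)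
    (h0 : ∀ x, 0 ≤ ρ x) (h1 : ∫ x, ρ x = 1) (hu : MemLp u 2) (x) :
    ‖smear ρ u x - u x‖ₑ ^ 2 ≤ ∫⁻ t, ‖ρ t‖ₑ * ‖u (x - t) - u x‖ₑ ^ 2 := by
  have hi : Integrable ρ := hρ.integrable_of_hasCompactSupport hc
  have hL : ∫⁻ t, ‖ρ t‖ₑ = 1 := by
    have := ofReal_integral_eq_lintegral_ofReal hi (Eventually.of_forall h0)
    rw [h1] at this
    simp only [Real.enorm_eq_ofReal (h0 _)]
    simpa using this.symm
  have hmeas : AEMeasurable (fun t => ‖u (x - t) - u x‖ₑ) :=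
    ((hu.1.comp_quasiMeasurePreserving
      (quasiMeasurePreserving_sub_left_of_right_invariant volume x)).sub
      aestronglyMeasurable_const).enorm
  have e1 : smear ρ u x - u x = ∫ t, ρ t * (u (x - t) - u x) := by
    simp only [mul_sub]
    rw [integral_sub (integrable_smear_integrand hρ hc
      (hu.locallyIntegrable (by norm_num)) x) (hi.mul_const _), integral_mul_const, h1, one_mul,
      smear_apply_swap]
  have e2 : ‖smear ρ u x - u x‖ₑ ≤ ∫⁻ t, ‖ρ t‖ₑ * ‖u (x - t) - u x‖ₑ := by
    rw [e1]
    refine (enorm_integral_le_lintegral_enorm _).trans_eq ?_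
    simp only [enorm_mul]
  have hρm : AEMeasurable (fun t => ‖ρ t‖ₑ) := hρ.aestronglyMeasurable.enorm
  have e3 := ENNReal.lintegral_mul_le_Lp_mul_Lq volume (p := 2) (q := 2)
    Real.HolderConjugate.two_two
    (f := fun t => ‖ρ t‖ₑ ^ (1 / 2 : ℝ)) (g := fun t => ‖ρ t‖ₑ ^ (1 / 2 : ℝ) * ‖u (x - t) - u x‖ₑ)
    (hρm.pow_const _) ((hρm.pow_const _).mul hmeas)
  have s1 : ∀ a : ℝ≥0∞, a ^ (1 / 2 : ℝ) * a ^ (1 / 2 : ℝ) = a := fun a => by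
    rw [← ENNReal.rpow_add_of_nonneg _ _ (by norm_num) (by norm_num)]; norm_num
  have s2 : ∀ a : ℝ≥0∞, (a ^ (1 / 2 : ℝ)) ^ (2 : ℝ) = a := fun a => by
    rw [← ENNReal.rpow_mul]; norm_num
  simp only [Pi.mul_apply, ← mul_assoc, s1, ENNReal.mul_rpow_of_nonneg _ _ zero_le_two, s2, hL,
    ENNReal.one_rpow, one_mul] at e3
  calc ‖smear ρ u x - u x‖ₑ ^ 2
      ≤ ((∫⁻ t, ‖ρ t‖ₑ * ‖u (x - t) - u x‖ₑ ^ (2 : ℝ)) ^ (1 / 2 : ℝ)) ^ 2 := by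
        gcongr; exact e2.trans e3
    _ = _ := by
        rw [← ENNReal.rpow_natCast, ← ENNReal.rpow_mul]; norm_num

/-- Integrate the pointwise Jensen bound in `x` and exchange the integrals: the error is a
`ρ`-average of squared translation errors. -/
theorem eLpNorm_smear_sub_le (hρ : Continuous ρ) (hc : HasCompactSupport ρ)
    (h0 : ∀ x, 0 ≤ ρ x) (h1 : ∫ x, ρ x = 1) (hu : MemLp u 2) {ε : ℝ≥0∞}
    (hε : ∀ t ∈ tsupport ρ, eLpNorm (fun x => u (x - t) - u x) 2 ≤ ε) :
    eLpNorm (fun x => smear ρ u x - u x) 2 ≤ ε := by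
  have hi : Integrable ρ := hρ.integrable_of_hasCompactSupport hc
  have hL : ∫⁻ t, ‖ρ t‖ₑ = 1 := by
    have := ofReal_integral_eq_lintegral_ofReal hi (Eventually.of_forall h0)
    rw [h1] at this
    simp only [Real.enorm_eq_ofReal (h0 _)]
    simpa using this.symm
  have key : ∀ v : EuclideanSpace ℝ (Fin n) → ℝ, eLpNorm v 2 ^ 2 = ∫⁻ x, ‖v x‖ₑ ^ 2 := fun v => by
    rw [eLpNorm_eq_lintegral_rpow_enorm_toReal (by norm_num) (by norm_num),
      ← ENNReal.rpow_natCast, ← ENNReal.rpow_mul]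
    norm_num
  have hm : AEMeasurable (fun p : EuclideanSpace ℝ (Fin n) × EuclideanSpace ℝ (Fin n) =>
      ‖ρ p.2‖ₑ * ‖u (p.1 - p.2) - u p.1‖ₑ ^ 2) (volume.prod volume) := by
    refine AEMeasurable.mul (hρ.comp continuous_snd).aestronglyMeasurable.enorm
      (AEMeasurable.pow_const ?_ 2)
    exact ((hu.1.comp_quasiMeasurePreserving
      (quasiMeasurePreserving_sub_of_right_invariant volume volume)).sub hu.1.comp_fst).enorm
  rw [← ENNReal.pow_le_pow_left_iff two_ne_zero, key]
  calc ∫⁻ x, ‖smear ρ u x - u x‖ₑ ^ 2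
      ≤ ∫⁻ x, ∫⁻ t, ‖ρ t‖ₑ * ‖u (x - t) - u x‖ₑ ^ 2 :=
        lintegral_mono fun x => enorm_smear_sub_sq_le hρ hc h0 h1 hu x
    _ = ∫⁻ t, ∫⁻ x, ‖ρ t‖ₑ * ‖u (x - t) - u x‖ₑ ^ 2 := lintegral_lintegral_swap hm
    _ ≤ ∫⁻ t, ‖ρ t‖ₑ * ε ^ 2 := by
        refine lintegral_mono fun t => ?_
        rw [lintegral_const_mul' _ _ (by simp)]
        by_cases ht : t ∈ tsupport ρ
        · gcongr
          rw [← key]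
          gcongr
          exact hε t ht
        · simp [image_eq_zero_of_notMem_tsupport ht]
    _ = ε ^ 2 := by
        rw [lintegral_mul_const'' _ hρ.aestronglyMeasurable.enorm, hL, one_mul]

theorem tendsto_eLpNorm_smear_sub (hu : MemLp u 2) :
    Tendsto (fun k => eLpNorm (fun x => smear (mollifier n k) u x - u x) 2) atTop (𝓝 0) := by
  rw [ENNReal.tendsto_nhds_zero]
  intro ε hε
  obtain ⟨δ, hδ, h⟩ := Metric.eventually_nhds_iff.1
    (ENNReal.tendsto_nhds_zero.1 (tendsto_eLpNorm_translate_sub hu) ε hε)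
  filter_upwards [tendsto_one_div_add_atTop_nhds_zero_nat.eventually_lt_const hδ] with k hk
  refine eLpNorm_smear_sub_le (contDiff_mollifier k).continuous (hasCompactSupport_mollifier k)
    (mollifier_nonneg k) (integral_mollifier k) hu fun t ht => h ?_
  rw [tsupport_mollifier] at ht
  exact (Metric.mem_closedBall.1 ht).trans_lt hk

theorem memLp_smear (hρ : ContDiff ℝ ∞ ρ) (hc : HasCompactSupport ρ)
    (h0 : ∀ x, 0 ≤ ρ x) (h1 : ∫ x, ρ x = 1) (hu : MemLp u 2) : MemLp (smear ρ u) 2 := by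
  have hcont := (hρ.smear hc (hu.locallyIntegrable (by norm_num))).continuous
  have : MemLp (fun x => smear ρ u x - u x) 2 := by
    -- The crude bound `2‖u‖` holds for every translation error, since translations preserve the
    -- norm.
    refine ⟨hcont.aestronglyMeasurable.sub hu.1, (eLpNorm_smear_sub_le hρ.continuous hc h0 h1 hu
      (ε := eLpNorm u 2 + eLpNorm u 2) fun t _ => ?_).trans_lt (by simp [hu.2])⟩
    have hmp := measurePreserving_sub_right (volume : Measure (EuclideanSpace ℝ (Fin n))) t
    refine (eLpNorm_sub_le (f := fun x => u (x - t)) (hu.comp_measurePreserving hmp).1 hu.1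
      (by norm_num)).trans ?_
    gcongr
    exact (eLpNorm_comp_measurePreserving hu.1 hmp).le
  have h2 := this.add hu
  rwa [show ((fun x => smear ρ u x - u x) + u) = smear ρ u by ext; simp] at h2

end Mollify

/-! ### Limits of integrals under `L²` convergence. -/

section Limits

open Filter Topology

variable {α : Type*} [MeasurableSpace α] {μ : Measure α}

theorem tendsto_integral_mul_of_tendsto_eLpNorm {a b : ℕ → α → ℝ} {A B : α → ℝ}
    (ha : ∀ k, MemLp (a k) 2 μ) (hA : MemLp A 2 μ) (hb : ∀ k, MemLp (b k) 2 μ) (hB : MemLp B 2 μ)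
    (haA : Tendsto (fun k => eLpNorm (a k - A) 2 μ) atTop (𝓝 0))
    (hbB : Tendsto (fun k => eLpNorm (b k - B) 2 μ) atTop (𝓝 0)) :
    Tendsto (fun k => ∫ x, a k x * b k x ∂μ) atTop (𝓝 (∫ x, A x * B x ∂μ)) := by
  have h1 := (Lp.tendsto_Lp_iff_tendsto_eLpNorm'' a ha A hA).2 haA
  have h2 := (Lp.tendsto_Lp_iff_tendsto_eLpNorm'' b hb B hB).2 hbB
  have key : ∀ (f g : α → ℝ) (hf : MemLp f 2 μ) (hg : MemLp g 2 μ),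
      inner ℝ (hf.toLp f) (hg.toLp g) = ∫ x, f x * g x ∂μ := fun f g hf hg => by
    rw [L2.inner_def]
    refine integral_congr_ae ?_
    filter_upwards [hf.coeFn_toLp, hg.coeFn_toLp] with x h1 h2
    simp [h1, h2, mul_comm]
  simpa only [key] using h1.inner (𝕜 := ℝ) h2

theorem tendsto_eLpNorm_bdd_mul {m : α → ℝ} {C : ℝ} (hmC : ∀ x, |m x| ≤ C)
    {b : ℕ → α → ℝ} {B : α → ℝ} (hbB : Tendsto (fun k => eLpNorm (b k - B) 2 μ) atTop (𝓝 0)) :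
    Tendsto (fun k => eLpNorm ((fun x => m x * b k x) - fun x => m x * B x) 2 μ) atTop (𝓝 0) := by
  have h : Tendsto (fun k => ENNReal.ofReal C * eLpNorm (b k - B) 2 μ) atTop (𝓝 0) := by
    simpa using ENNReal.Tendsto.const_mul hbB (Or.inr ENNReal.ofReal_ne_top)
  refine tendsto_of_tendsto_of_tendsto_of_le_of_le tendsto_const_nhds h (fun _ => zero_le)
    fun k => eLpNorm_le_mul_eLpNorm_of_ae_le_mul (Eventually.of_forall fun x => ?_) _
  simp only [Pi.sub_apply, ← mul_sub, norm_mul, Real.norm_eq_abs]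
  gcongr
  exact hmC x

end Limits

/-! ### A weighted mean value inequality. -/

section MeanValue

open Filter Topology

variable {n : ℕ}

/-- A smooth radial bump function supported in the unit ball. -/
noncomputable def bumpPotential (z : EuclideanSpace ℝ (Fin n)) : ℝ := expNegInvGlue (1 - ‖z‖ ^ 2)

/-- The averaging kernel `ρ` with `ρ(z) z = -∇ bumpPotential`. -/
noncomputable def meanKernel (z : EuclideanSpace ℝ (Fin n)) : ℝ :=
  2 * ((1 - ‖z‖ ^ 2)⁻¹ ^ 2 * expNegInvGlue (1 - ‖z‖ ^ 2))

/-- Valid for every `s`: for `s ≤ 0` the factor `expNegInvGlue s` vanishes, including at `0`, where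
the inverse is `0` by convention. -/
theorem hasDerivAt_expNegInvGlue (s : ℝ) :
    HasDerivAt expNegInvGlue (s⁻¹ ^ 2 * expNegInvGlue s) s := by
  simpa using expNegInvGlue.hasDerivAt_polynomial_eval_inv_mul 1 s

theorem contDiff_bumpPotential : ContDiff ℝ ∞ (bumpPotential (n := n)) :=
  expNegInvGlue.contDiff.comp (contDiff_const.sub (contDiff_norm_sq ℝ))

theorem continuous_meanKernel : Continuous (meanKernel (n := n)) := by
  have h : meanKernel (n := n) = fun z => 2 * deriv expNegInvGlue (1 - ‖z‖ ^ 2) := by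
    ext z; rw [(hasDerivAt_expNegInvGlue _).deriv]; rfl
  have hd : Continuous (deriv expNegInvGlue) :=
    (expNegInvGlue.contDiff (n := 1)).continuous_deriv le_rfl
  rw [h]
  exact continuous_const.mul (hd.comp (by fun_prop))

theorem meanKernel_nonneg (z : EuclideanSpace ℝ (Fin n)) : 0 ≤ meanKernel z := by
  have := expNegInvGlue.nonneg (1 - ‖z‖ ^ 2)
  unfold meanKernel; positivity

theorem bumpPotential_nonneg (z : EuclideanSpace ℝ (Fin n)) : 0 ≤ bumpPotential z :=
  expNegInvGlue.nonneg _

theorem bumpPotential_eq_zero {z : EuclideanSpace ℝ (Fin n)} (hz : 1 ≤ ‖z‖) :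
    bumpPotential z = 0 :=
  expNegInvGlue.zero_of_nonpos (by nlinarith)

theorem meanKernel_eq_zero {z : EuclideanSpace ℝ (Fin n)} (hz : 1 ≤ ‖z‖) : meanKernel z = 0 := by
  simp [meanKernel, expNegInvGlue.zero_of_nonpos (show 1 - ‖z‖ ^ 2 ≤ 0 by nlinarith)]

/-- Inside the unit ball `(1 - ‖z‖²)⁻¹ ≥ 1`. This comparison lets the derivative of a dilated mean
be bounded by the mean itself. -/
theorem two_mul_bumpPotential_le_meanKernel (z : EuclideanSpace ℝ (Fin n)) :
    2 * bumpPotential z ≤ meanKernel z := by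
  rcases le_or_gt 1 ‖z‖ with h | h
  · rw [bumpPotential_eq_zero h, meanKernel_eq_zero h, mul_zero]
  · have h1 : 0 < 1 - ‖z‖ ^ 2 := by nlinarith [norm_nonneg z]
    have h2 : 1 ≤ (1 - ‖z‖ ^ 2)⁻¹ := (one_le_inv₀ h1).2 (by nlinarith [norm_nonneg z])
    have h3 := expNegInvGlue.nonneg (1 - ‖z‖ ^ 2)
    unfold bumpPotential meanKernel
    gcongr
    exact le_mul_of_one_le_left h3 (one_le_pow₀ h2)

theorem hasCompactSupport_bumpPotential : HasCompactSupport (bumpPotential (n := n)) :=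
  HasCompactSupport.of_support_subset_isCompact (isCompact_closedBall 0 1) fun z hz => by
    by_contra h
    exact hz (bumpPotential_eq_zero (by simpa using (not_le.1 (by simpa using h)).le))

theorem hasCompactSupport_meanKernel : HasCompactSupport (meanKernel (n := n)) :=
  HasCompactSupport.of_support_subset_isCompact (isCompact_closedBall 0 1) fun z hz => by
    by_contra h
    exact hz (meanKernel_eq_zero (by simpa using (not_le.1 (by simpa using h)).le))

theorem pd_bumpPotential (i : Fin n) (z : EuclideanSpace ℝ (Fin n)) :
    pd i bumpPotential z = -(z i * meanKernel z) := by
  have h1 := (hasStrictFDerivAt_norm_sq z).hasFDerivAt.const_sub 1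
  have := ((hasDerivAt_expNegInvGlue (1 - ‖z‖ ^ 2)).comp_hasFDerivAt z h1).fderiv
  rw [pd, show bumpPotential (n := n) = expNegInvGlue ∘ fun z => 1 - ‖z‖ ^ 2 from rfl, this]
  simp [meanKernel, EuclideanSpace.inner_single_right]
  ring

theorem integral_meanKernel_pos : 0 < ∫ z : EuclideanSpace ℝ (Fin n), meanKernel z := by
  refine continuous_meanKernel.integral_pos_of_hasCompactSupport_nonneg_nonzero
    hasCompactSupport_meanKernel meanKernel_nonneg (x := 0) ?_
  have := expNegInvGlue.pos_of_pos one_pos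
  simp [meanKernel, this.ne']

variable {u : EuclideanSpace ℝ (Fin n) → ℝ}

/-- Differentiating gives `∫ ∇u(x + sz)·z meanKernel z`; since `z meanKernel z` is minus the
gradient of `bumpPotential`, one integration by parts yields the Laplacian and a factor `s`. -/
theorem hasDerivAt_integral_dilation (hu : ContDiff ℝ ∞ u) (x : EuclideanSpace ℝ (Fin n)) (s : ℝ) :
    HasDerivAt (fun s => ∫ z, u (x + s • z) * meanKernel z)
      (s * ∫ z, lap u (x + s • z) * bumpPotential z) s := by
  have hcont : Continuous fun p : ℝ × EuclideanSpace ℝ (Fin n) =>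
      fderiv ℝ u (x + p.1 • p.2) p.2 :=
    ((hu.continuous_fderiv (by simp)).comp (by fun_prop)).clm_apply continuous_snd
  obtain ⟨C, hC⟩ := ((isCompact_closedBall s 1).prod (isCompact_closedBall 0 1)).exists_bound_of_continuousOn
    hcont.continuousOn
  have hd := hasDerivAt_integral_of_dominated_loc_of_deriv_le (μ := volume)
    (F := fun s z => u (x + s • z) * meanKernel z)
    (F' := fun s z => fderiv ℝ u (x + s • z) z * meanKernel z) (x₀ := s)
    (bound := fun z => C * meanKernel z) (s := Metric.ball s 1) (Metric.ball_mem_nhds s one_pos)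
    (Eventually.of_forall fun s => ((hu.continuous.comp (by fun_prop)).mul
      continuous_meanKernel).aestronglyMeasurable)
    (((hu.continuous.comp (by fun_prop)).mul
      continuous_meanKernel).integrable_of_hasCompactSupport
      hasCompactSupport_meanKernel.mul_left)
    (((hcont.comp (Continuous.prodMk continuous_const continuous_id)).mul
      continuous_meanKernel).aestronglyMeasurable)
    (Eventually.of_forall fun z t ht => ?_)
    ((continuous_meanKernel.integrable_of_hasCompactSupport
      hasCompactSupport_meanKernel).const_mul C)
    (Eventually.of_forall fun z t _ => ?_)
  · refine hd.2.congr_deriv ?_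
    have e : ∀ z, fderiv ℝ u (x + s • z) z * meanKernel z =
        ∑ i, -(pd i bumpPotential z * pd i u (x + s • z)) := fun z => by
      have hz : z = ∑ i, z i • EuclideanSpace.single i (1 : ℝ) := by
        simpa using ((EuclideanSpace.basisFun (Fin n) ℝ).sum_repr z).symm
      conv_lhs => rw [hz]
      rw [map_sum, Finset.sum_mul, ← hz]
      refine Finset.sum_congr rfl fun i _ => ?_
      rw [pd_bumpPotential, map_smul, smul_eq_mul]
      simp only [pd]; ring
    simp only [e, lap, Finset.sum_mul]
    rw [integral_finsetSum, integral_finsetSum, Finset.mul_sum]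
    · refine Finset.sum_congr rfl fun i _ => ?_
      have hg : ContDiff ℝ ∞ fun z => pd i u (x + s • z) :=
        (hu.pd i).comp (contDiff_const.add (contDiff_id.const_smul s))
      rw [integral_neg, ← integral_mul_pd contDiff_bumpPotential hg hasCompactSupport_bumpPotential,
        pd_comp_add_smul (hu.pd i), ← integral_const_mul]
      congr 1; ext z; ring
    · exact fun i _ => ((((hu.pd i).pd i).continuous.comp (by fun_prop)).mul
        contDiff_bumpPotential.continuous).integrable_of_hasCompactSupport
        hasCompactSupport_bumpPotential.mul_left
    · exact fun i _ => (((contDiff_bumpPotential.pd i).continuous.mul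
        ((hu.pd i).continuous.comp (by fun_prop))).integrable_of_hasCompactSupport
        (hasCompactSupport_bumpPotential.pd i).mul_right).neg
  · rw [norm_mul, Real.norm_of_nonneg (meanKernel_nonneg z)]
    rcases le_or_gt 1 ‖z‖ with h | h
    · simp [meanKernel_eq_zero h]
    · gcongr
      · exact meanKernel_nonneg z
      · exact hC (t, z) ⟨Metric.ball_subset_closedBall ht, by simpa using h.le⟩
  · have h1 : HasDerivAt (fun t : ℝ => x + t • z) z t := by
      simpa using ((hasDerivAt_id t).smul_const z).const_add x
    exact ((hu.differentiableAt_infty _).hasFDerivAt.comp_hasDerivAt t h1).mul_const _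

/-- A smooth mean value inequality for nonnegative supersolutions of `-Δ + M`. -/
theorem exp_mul_integral_dilation_le (hu : ContDiff ℝ ∞ u) {x : EuclideanSpace ℝ (Fin n)} {r M : ℝ}
    (hr : 0 < r) (hM : 0 ≤ M) (h0 : ∀ y ∈ Metric.ball x r, 0 ≤ u y)
    (hl : ∀ y ∈ Metric.ball x r, lap u y ≤ M * u y) :
    Real.exp (-(M / 4 * r ^ 2)) * ∫ z, u (x + r • z) * meanKernel z ≤
      u x * ∫ z : EuclideanSpace ℝ (Fin n), meanKernel z := by
  -- On `0 < s < r` one has `I' ≤ (M/2) s I`, so `exp(-M s²/4)` is the integrating factor making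
  -- `exp(-M s²/4) I` decreasing. At `s = 0` it equals `u x` times the mass of the kernel.
  set I : ℝ → ℝ := fun s => ∫ z, u (x + s • z) * meanKernel z with hI
  have hd : ∀ s, HasDerivAt (fun s => Real.exp (-(M / 4 * s ^ 2)) * I s)
      (Real.exp (-(M / 4 * s ^ 2)) * (s * ∫ z, lap u (x + s • z) * bumpPotential z) -
        Real.exp (-(M / 4 * s ^ 2)) * (M / 2 * s) * I s) s := fun s => by
    have h1 := (((hasDerivAt_pow 2 s).const_mul (M / 4)).neg.exp).mul
      (hasDerivAt_integral_dilation hu x s)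
    refine h1.congr_deriv ?_
    simp only [hI]
    norm_num
    ring
  have hanti : AntitoneOn (fun s => Real.exp (-(M / 4 * s ^ 2)) * I s) (Set.Icc 0 r) := by
    refine antitoneOn_of_deriv_nonpos (convex_Icc 0 r)
      (fun s _ => (hd s).continuousAt.continuousWithinAt)
      (fun s _ => (hd s).differentiableAt.differentiableWithinAt) fun s hs => ?_
    rw [interior_Icc] at hs
    rw [(hd s).deriv]
    have hmem : ∀ z : EuclideanSpace ℝ (Fin n), ‖z‖ < 1 → x + s • z ∈ Metric.ball x r := by
      intro z hz
      rw [Metric.mem_ball, dist_self_add_left, norm_smul, Real.norm_of_nonneg hs.1.le]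
      nlinarith [hs.1, hs.2]
    have hle : ∫ z, lap u (x + s • z) * bumpPotential z ≤ M / 2 * I s := by
      rw [hI, ← integral_const_mul]
      refine integral_mono ?_ ?_ fun z => ?_
      · exact ((hu.lap.continuous.comp (by fun_prop)).mul
          contDiff_bumpPotential.continuous).integrable_of_hasCompactSupport
          hasCompactSupport_bumpPotential.mul_left
      · exact (((hu.continuous.comp (by fun_prop)).mul
          continuous_meanKernel).integrable_of_hasCompactSupport
          hasCompactSupport_meanKernel.mul_left).const_mul _
      · rcases le_or_gt 1 ‖z‖ with h | h
        · simp [meanKernel_eq_zero h, bumpPotential_eq_zero h]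
        · have a1 := mul_le_mul_of_nonneg_right (hl _ (hmem z h)) (bumpPotential_nonneg z)
          have a2 := mul_le_mul_of_nonneg_left (two_mul_bumpPotential_le_meanKernel z)
            (mul_nonneg hM (h0 _ (hmem z h)))
          simp only
          linarith
    have e := Real.exp_pos (-(M / 4 * s ^ 2))
    have : Real.exp (-(M / 4 * s ^ 2)) * s * (∫ z, lap u (x + s • z) * bumpPotential z) ≤
        Real.exp (-(M / 4 * s ^ 2)) * s * (M / 2 * I s) :=
      mul_le_mul_of_nonneg_left hle (mul_nonneg e.le hs.1.le)
    linarith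
  have := hanti (Set.left_mem_Icc.2 hr.le) (Set.right_mem_Icc.2 hr.le) hr.le
  simpa [hI, integral_const_mul] using this

end MeanValue

/-! ### The scalar strong maximum principle. -/

section StrongMaximum

open Filter Topology

variable {n : ℕ} {u : EuclideanSpace ℝ (Fin n) → ℝ}

theorem MeasureTheory.LocallyIntegrable.integrable_mul (hu : LocallyIntegrable u)
    {f : EuclideanSpace ℝ (Fin n) → ℝ} (hf : Continuous f) (hc : HasCompactSupport f) :
    Integrable fun x => u x * f x := by
  simpa only [smul_eq_mul, mul_comm] using hu.integrable_smul_left_of_hasCompactSupport hf hc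

theorem smear_nonneg {ρ : EuclideanSpace ℝ (Fin n) → ℝ} (hρ : ∀ x, 0 ≤ ρ x)
    (hu : 0 ≤ᵐ[volume] u) (x) : 0 ≤ smear ρ u x :=
  integral_nonneg_of_ae (by filter_upwards [hu] with y hy using mul_nonneg (hρ _) hy)

theorem lap_reflect {ρ : EuclideanSpace ℝ (Fin n) → ℝ} (hρ : ContDiff ℝ ∞ ρ)
    (x : EuclideanSpace ℝ (Fin n)) : lap (fun y => ρ (x - y)) = fun y => lap ρ (x - y) := by
  have h : ∀ f : EuclideanSpace ℝ (Fin n) → ℝ, ContDiff ℝ ∞ f → ∀ i,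
      pd i (fun y => f (x - y)) = fun y => -1 * pd i f (x - y) := fun f hf i => by
    simpa [sub_eq_add_neg] using pd_comp_add_smul hf (-1) x i
  ext y
  refine Finset.sum_congr rfl fun i _ => ?_
  have h2 : ContDiff ℝ ∞ fun z => -1 * pd i ρ z := contDiff_const.mul (hρ.pd i)
  rw [h ρ hρ i, h _ h2 i]
  have : pd i (fun z => -1 * pd i ρ z) = fun z => -1 * pd i (pd i ρ) z := by
    ext z
    rw [pd, fderiv_const_mul ((hρ.pd i).differentiableAt_infty z)]
    rfl
  rw [this]; ring

theorem hasCompactSupport_reflect {ρ : EuclideanSpace ℝ (Fin n) → ℝ} (hc : HasCompactSupport ρ)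
    (x : EuclideanSpace ℝ (Fin n)) : HasCompactSupport fun y => ρ (x - y) :=
  hc.comp_homeomorph (Homeomorph.subLeft x)

theorem contDiff_reflect {ρ : EuclideanSpace ℝ (Fin n) → ℝ} (hρ : ContDiff ℝ ∞ ρ)
    (x : EuclideanSpace ℝ (Fin n)) : ContDiff ℝ ∞ fun y => ρ (x - y) :=
  hρ.comp (contDiff_const.sub contDiff_id)

theorem mollifier_reflect_eq_zero {k : ℕ} {x y : EuclideanSpace ℝ (Fin n)}
    (h : (1 / (k + 1) : ℝ) < dist y x) : mollifier n k (x - y) = 0 := by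
  refine image_eq_zero_of_notMem_tsupport fun h' => ?_
  rw [tsupport_mollifier, mem_closedBall_zero_iff, ← dist_eq_norm, dist_comm] at h'
  linarith

/-- The local strong maximum principle: a nonnegative distributional supersolution of `-Δ + M` is
bounded below by its mass near a point. -/
theorem exists_mul_integral_ball_le (hu : MemLp u 2) (h0 : 0 ≤ᵐ[volume] u) {M r : ℝ} (hM : 0 ≤ M)
    (hr : 0 < r) (x₀ : EuclideanSpace ℝ (Fin n))
    (h : ∀ φ : EuclideanSpace ℝ (Fin n) → ℝ, ContDiff ℝ ∞ φ → HasCompactSupport φ →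
      (∀ x, 0 ≤ φ x) → (∀ x ∉ Metric.closedBall x₀ (5 * r), φ x = 0) →
      0 ≤ ∫ x, u x * (M * φ x - lap φ x)) :
    ∃ c : ℝ, 0 < c ∧ ∀ᵐ x ∂volume.restrict (Metric.ball x₀ r),
      c * ∫ y in Metric.ball x₀ r, u y ≤ u x := by
  have hloc : LocallyIntegrable u := hu.locallyIntegrable (by norm_num)
  set w : ℕ → EuclideanSpace ℝ (Fin n) → ℝ := fun k => smear (mollifier n k) u with hw
  have hws : ∀ k, ContDiff ℝ ∞ (w k) := fun k =>
    (contDiff_mollifier k).smear (hasCompactSupport_mollifier k) hloc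
  have hw0 : ∀ k x, 0 ≤ w k x := fun k => smear_nonneg (mollifier_nonneg k) h0
  -- Lower bound for the kernel on `‖z‖ ≤ 2/3`, where `1 - ‖z‖² ≥ 5/9` and its inverse is at most
  -- `3`.
  set c₀ : ℝ := 2 * Real.exp (-3) with hc₀
  have hker : ∀ z : EuclideanSpace ℝ (Fin n), ‖z‖ ≤ 2 / 3 → c₀ ≤ meanKernel z := fun z hz => by
    have h1 : 5 / 9 ≤ 1 - ‖z‖ ^ 2 := by nlinarith [norm_nonneg z]
    have h2 : 1 ≤ (1 - ‖z‖ ^ 2)⁻¹ := (one_le_inv₀ (by linarith)).2 (by nlinarith [norm_nonneg z])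
    have h3 : (1 - ‖z‖ ^ 2)⁻¹ ≤ 3 := by
      rw [inv_le_comm₀ (by linarith) (by norm_num)]; linarith
    unfold meanKernel
    rw [expNegInvGlue, if_neg (by linarith)]
    have : Real.exp (-3) ≤ Real.exp (-(1 - ‖z‖ ^ 2)⁻¹) := Real.exp_le_exp.2 (by linarith)
    rw [hc₀]
    gcongr
    exact this.trans (le_mul_of_one_le_left (Real.exp_pos _).le (one_le_pow₀ h2))
  set S : ℝ := ∫ z : EuclideanSpace ℝ (Fin n), meanKernel z with hS
  have hSpos : 0 < S := integral_meanKernel_pos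
  -- Jacobian of the change of variables `y = x + 3r z`.
  set J : ℝ := |((3 * r) ^ n)⁻¹| with hJ
  have hJpos : 0 < J := by positivity
  set e : ℝ := Real.exp (-(M / 4 * (3 * r) ^ 2)) with he
  have hepos : 0 < e := Real.exp_pos _
  have main : ∀ k : ℕ, (1 / (k + 1) : ℝ) < r → ∀ x ∈ Metric.ball x₀ r,
      e * c₀ * J / S * ∫ y in Metric.ball x₀ r, w k y ≤ w k x := by
    intro k hk x hx
    have hl : ∀ y ∈ Metric.ball x (3 * r), lap (w k) y ≤ M * w k y := by
      intro y hy
      have := h (fun t => mollifier n k (y - t)) (contDiff_reflect (contDiff_mollifier k) y)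
        (hasCompactSupport_reflect (hasCompactSupport_mollifier k) y)
        -- The radius `5r` comes from here: `x` is within `r` of `x₀`, `y` within `3r` of `x`, and
        -- the mollifier has radius below `r`.
        (fun t => mollifier_nonneg k _) fun t ht => mollifier_reflect_eq_zero (by
          have a1 := dist_triangle t y x₀
          have a2 := dist_triangle y x x₀
          simp only [Metric.mem_closedBall, not_le, Metric.mem_ball] at ht hx hy
          linarith)
      rw [lap_reflect (contDiff_mollifier k)] at this
      have e1 : ∀ t, u t * (M * mollifier n k (y - t) - lap (mollifier n k) (y - t)) =
          M * (mollifier n k (y - t) * u t) - lap (mollifier n k) (y - t) * u t := fun t => by ring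
      have i1 : Integrable fun t => mollifier n k (y - t) * u t :=
        (HasCompactSupport.convolutionExists_left (ContinuousLinearMap.lsmul ℝ ℝ)
        (hasCompactSupport_mollifier k) (contDiff_mollifier k).continuous hloc y).integrable_swap
      have i2 : Integrable fun t => lap (mollifier n k) (y - t) * u t :=
        (HasCompactSupport.convolutionExists_left (ContinuousLinearMap.lsmul ℝ ℝ)
        (hasCompactSupport_mollifier k).lap (contDiff_mollifier k).lap.continuous hloc
        y).integrable_swap
      simp only [e1] at this
      rw [integral_sub (i1.const_mul M) i2, integral_const_mul] at this
      rw [hw, lap_smear (contDiff_mollifier k) (hasCompactSupport_mollifier k) hloc]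
      simp only [smear]
      linarith
    -- With dilation `3r`, the ball `B(x₀, r) ⊆ B(x, 2r)` corresponds to `‖z‖ ≤ 2/3`, where the
    -- kernel is at least `c₀`.
    have mv := exp_mul_integral_dilation_le (hws k) (x := x) (r := 3 * r) (by positivity) hM
      (fun y _ => hw0 k y) hl
    have cv : c₀ * (J * ∫ y in Metric.ball x₀ r, w k y) ≤
        ∫ z, w k (x + (3 * r) • z) * meanKernel z := by
      set F : EuclideanSpace ℝ (Fin n) → ℝ := (Metric.ball x₀ r).indicator (w k) with hF
      have t1 : ∫ z, F (x + (3 * r) • z) = J * ∫ y in Metric.ball x₀ r, w k y := by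
        rw [Measure.integral_comp_smul volume (fun z => F (x + z)), integral_add_left_eq_self,
          integral_indicator measurableSet_ball]
        simp [hJ]
      have hFi : Integrable F := by
        rw [hF, integrable_indicator_iff measurableSet_ball]
        exact ((hws k).continuous.locallyIntegrable.integrableOn_isCompact
          (isCompact_closedBall x₀ r)).mono_set Metric.ball_subset_closedBall
      rw [← t1, ← integral_const_mul]
      refine integral_mono (((hFi.comp_add_left x).comp_smul (by positivity)).const_mul _)
        ((((hws k).continuous.comp (by fun_prop)).mul
          continuous_meanKernel).integrable_of_hasCompactSupport
          hasCompactSupport_meanKernel.mul_left) fun z => ?_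
      simp only [hF, Set.indicator]
      split_ifs with hz
      · rw [mul_comm]
        refine mul_le_mul_of_nonneg_left (hker z ?_) (hw0 k _)
        have a1 : dist (x + (3 * r) • z) x ≤ 2 * r := by
          have := dist_triangle_right (x + (3 * r) • z) x x₀
          simp only [Metric.mem_ball] at hz hx
          linarith
        rw [dist_self_add_left, norm_smul, Real.norm_of_nonneg (by positivity)] at a1
        have : r * (3 * ‖z‖) ≤ r * 2 := by linarith
        linarith [le_of_mul_le_mul_left this hr]
      · rw [mul_zero]; exact mul_nonneg (hw0 k _) (meanKernel_nonneg z)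
    rw [div_mul_eq_mul_div, div_le_iff₀ hSpos]
    calc e * c₀ * J * ∫ y in Metric.ball x₀ r, w k y
        = e * (c₀ * (J * ∫ y in Metric.ball x₀ r, w k y)) := by ring
      _ ≤ e * ∫ z, w k (x + (3 * r) • z) * meanKernel z := by gcongr
      _ ≤ _ := mv
  refine ⟨e * c₀ * J / S, by positivity, ?_⟩
  have hlim := tendsto_eLpNorm_smear_sub hu
  have hwm : ∀ k, MemLp (w k) 2 := fun k => memLp_smear (contDiff_mollifier k)
    (hasCompactSupport_mollifier k) (mollifier_nonneg k) (integral_mollifier k) hu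
  have hint : Tendsto (fun k => ∫ y in Metric.ball x₀ r, w k y) atTop
      (𝓝 (∫ y in Metric.ball x₀ r, u y)) := by
    have : IsFiniteMeasure (volume.restrict (Metric.ball x₀ r)) :=
      ⟨by simpa using measure_ball_lt_top⟩
    have hone : MemLp (fun _ => (1 : ℝ)) 2 (volume.restrict (Metric.ball x₀ r)) :=
      memLp_const 1
    simpa using tendsto_integral_mul_of_tendsto_eLpNorm (fun _ => hone) hone
      (fun k => (hwm k).restrict (Metric.ball x₀ r)) (hu.restrict _) (by simp)
      (tendsto_of_tendsto_of_tendsto_of_le_of_le tendsto_const_nhds hlim (fun _ => zero_le)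
        fun k => eLpNorm_mono_measure _ Measure.restrict_le_self)
  -- The constant does not depend on `k`, so the bound passes to `u` along an a.e. convergent
  -- subsequence.
  obtain ⟨ns, hns, hae⟩ := (tendstoInMeasure_of_tendsto_eLpNorm two_ne_zero
    (fun k => (hwm k).1) hu.1 hlim).exists_seq_tendsto_ae
  rw [ae_restrict_iff' measurableSet_ball]
  filter_upwards [hae] with x hx hxb
  refine le_of_tendsto_of_tendsto ((hint.comp hns.tendsto_atTop).const_mul _) hx ?_
  filter_upwards [hns.tendsto_atTop.eventually
    (tendsto_one_div_add_atTop_nhds_zero_nat.eventually_lt_const hr)] with k hk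
  exact main _ hk x hxb

/-- The strong maximum principle for nonnegative distributional supersolutions of `-Δ + q`. -/
theorem ae_eq_zero_or_locally_pos (hu : MemLp u 2) (h0 : 0 ≤ᵐ[volume] u)
    {q : EuclideanSpace ℝ (Fin n) → ℝ} (hq : Continuous q)
    (h : ∀ φ : EuclideanSpace ℝ (Fin n) → ℝ, ContDiff ℝ ∞ φ → HasCompactSupport φ →
      (∀ x, 0 ≤ φ x) → 0 ≤ ∫ x, u x * (q x * φ x - lap φ x)) :
    u =ᵐ[volume] 0 ∨ ∀ K : Set (EuclideanSpace ℝ (Fin n)), IsCompact K →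
      ∃ c : ℝ, 0 < c ∧ ∀ᵐ x ∂volume.restrict K, c ≤ u x := by
  have hloc : LocallyIntegrable u := hu.locallyIntegrable (by norm_num)
  -- `N` and `Q` are both open by definition. The local estimate makes them complementary: positive
  -- mass in a unit ball forces a positive lower bound there. Connectedness then leaves `N` empty or
  -- everything.
  set N : Set (EuclideanSpace ℝ (Fin n)) :=
    {x | ∃ U ∈ 𝓝 x, ∀ᵐ y ∂volume.restrict U, u y = 0} with hN
  set Q : Set (EuclideanSpace ℝ (Fin n)) :=
    {x | ∃ U ∈ 𝓝 x, ∃ c : ℝ, 0 < c ∧ ∀ᵐ y ∂volume.restrict U, c ≤ u y} with hQ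
  have hNopen : IsOpen N := isOpen_iff_mem_nhds.2 fun x ⟨U, hU, hx⟩ => by
    filter_upwards [eventually_mem_nhds_iff.2 hU] with y hy using ⟨U, hy, hx⟩
  have hQopen : IsOpen Q := isOpen_iff_mem_nhds.2 fun x ⟨U, hU, hx⟩ => by
    filter_upwards [eventually_mem_nhds_iff.2 hU] with y hy using ⟨U, hy, hx⟩
  have hdisj : Q = Nᶜ := by
    ext x
    constructor
    · rintro ⟨U, hU, c, hc, hUc⟩ ⟨W, hW, hW0⟩
      have hpos : 0 < volume (U ∩ W) := Measure.measure_pos_of_mem_nhds volume (inter_mem hU hW)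
      have h1 := ae_mono (Measure.restrict_mono (Set.inter_subset_left (s := U) (t := W)) le_rfl) hUc
      have h2 := ae_mono (Measure.restrict_mono (Set.inter_subset_right (s := U) (t := W)) le_rfl) hW0
      have h3 : ∀ᵐ y ∂volume.restrict (U ∩ W), False := by
        filter_upwards [h1, h2] with y hy1 hy2
        linarith
      simp only [eventually_false_iff_eq_bot, ae_eq_bot, Measure.restrict_eq_zero] at h3
      exact hpos.ne' h3
    · intro hx
      -- Locally `q ≤ max M 0`, and since `u ≥ 0` the potential may be increased to this constant.
      obtain ⟨M, hM⟩ := (isCompact_closedBall x (5 * 1)).bddAbove_image hq.continuousOn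
      obtain ⟨c, hc, hcu⟩ := exists_mul_integral_ball_le hu h0 (M := max M 0) (le_max_right _ _)
        one_pos x fun φ hφ hφc hφ0 hφs => by
          refine (h φ hφ hφc hφ0).trans ?_
          have key : ∀ f : EuclideanSpace ℝ (Fin n) → ℝ, Continuous f → HasCompactSupport f →
              Integrable fun y => u y * f y := fun f hf hfc => hloc.integrable_mul hf hfc
          refine integral_mono_ae
            (key _ ((hq.mul hφ.continuous).sub hφ.lap.continuous) (hφc.mul_left.sub hφc.lap))
            (key _ ((continuous_const.mul hφ.continuous).sub hφ.lap.continuous)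
              (hφc.mul_left.sub hφc.lap)) ?_
          filter_upwards [h0] with y hy
          refine mul_le_mul_of_nonneg_left ?_ hy
          by_cases hyb : y ∈ Metric.closedBall x (5 * 1)
          · have := mul_le_mul_of_nonneg_right
              ((hM ⟨y, hyb, rfl⟩).trans (le_max_left M 0)) (hφ0 y)
            linarith
          · simp [hφs y hyb]
      have hint : IntegrableOn u (Metric.ball x 1) :=
        (hloc.integrableOn_isCompact (isCompact_closedBall x 1)).mono_set
          Metric.ball_subset_closedBall
      have hnn : 0 ≤ᵐ[volume.restrict (Metric.ball x 1)] u := ae_restrict_of_ae h0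
      rcases (integral_nonneg_of_ae hnn).eq_or_lt with h1 | h1
      · exact absurd ⟨_, Metric.ball_mem_nhds x one_pos,
          (integral_eq_zero_iff_of_nonneg_ae hnn hint).1 h1.symm⟩ hx
      · exact ⟨_, Metric.ball_mem_nhds x one_pos, _, mul_pos hc h1, hcu⟩
  have hclopen : IsClopen N := ⟨⟨hdisj ▸ hQopen⟩, hNopen⟩
  rcases isClopen_iff.1 hclopen with hE | hE
  · right
    intro K hK
    refine hK.induction_on (p := fun s => ∃ c : ℝ, 0 < c ∧ ∀ᵐ x ∂volume.restrict s, c ≤ u x)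
      ⟨1, one_pos, by simp⟩ ?_ ?_ ?_
    · rintro s t hst ⟨c, hc, hcu⟩
      exact ⟨c, hc, ae_mono (Measure.restrict_mono hst le_rfl) hcu⟩
    · rintro s t ⟨c, hc, hcu⟩ ⟨c', hc', hcu'⟩
      refine ⟨min c c', lt_min hc hc', ae_restrict_union_iff _ _ _ |>.2 ⟨?_, ?_⟩⟩
      · filter_upwards [hcu] with x hx using (min_le_left _ _).trans hx
      · filter_upwards [hcu'] with x hx using (min_le_right _ _).trans hx
    · intro x _
      have : x ∈ Q := by rw [hdisj, hE]; simp
      obtain ⟨U, hU, hx⟩ := this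
      exact ⟨U, mem_nhdsWithin_of_mem_nhds hU, hx⟩
  · left
    refine measure_null_of_locally_null _ fun x _ => ?_
    have : x ∈ N := hE ▸ Set.mem_univ x
    obtain ⟨U, hU, hx⟩ := this
    obtain ⟨W, hWU, hW, hxW⟩ := mem_nhds_iff.1 hU
    have hx' := ae_mono (Measure.restrict_mono hWU le_rfl) hx
    replace hx' := (ae_restrict_iff' hW.measurableSet).1 hx'
    refine ⟨{y | u y = 0}ᶜ ∩ W, inter_mem self_mem_nhdsWithin
      (mem_nhdsWithin_of_mem_nhds (hW.mem_nhds hxW)), measure_mono_null ?_ hx'⟩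
    rintro y ⟨hy1, hy2⟩ hy3
    exact hy1 (hy3 hy2)

end StrongMaximum

/-! ### Local `L²` convergence. -/

section LocalL2

open Filter Topology

variable {n : ℕ}

/-- Convergence in `L²(B)`. -/
def TendstoL2On (B : Set (EuclideanSpace ℝ (Fin n))) (a : ℕ → EuclideanSpace ℝ (Fin n) → ℝ)
    (A : EuclideanSpace ℝ (Fin n) → ℝ) : Prop :=
  (∀ k, MemLp (a k) 2 (volume.restrict B)) ∧ MemLp A 2 (volume.restrict B) ∧
    Tendsto (fun k => eLpNorm (a k - A) 2 (volume.restrict B)) atTop (𝓝 0)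

variable {B : Set (EuclideanSpace ℝ (Fin n))} {a b : ℕ → EuclideanSpace ℝ (Fin n) → ℝ}
  {f g m : EuclideanSpace ℝ (Fin n) → ℝ}

theorem memLp_bdd_mul {μ : Measure (EuclideanSpace ℝ (Fin n))} (hm : Continuous m)
    (hc : HasCompactSupport m) (hf : MemLp f 2 μ) : MemLp (fun x => m x * f x) 2 μ := by
  obtain ⟨C, hC⟩ := hc.exists_bound_of_continuous hm
  refine hf.of_le_mul (hm.aestronglyMeasurable.mul hf.1) (c := C) (Eventually.of_forall fun x => ?_)
  rw [norm_mul]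
  gcongr
  exact hC x

theorem TendstoL2On.integral (ha : TendstoL2On B a f) (hb : TendstoL2On B b g)
    (hm : Continuous m) (hc : HasCompactSupport m) (hB : ∀ x ∉ B, m x = 0) :
    Tendsto (fun k => ∫ x, m x * (a k x * b k x)) atTop (𝓝 (∫ x, m x * (f x * g x))) := by
  have e : ∀ p q : EuclideanSpace ℝ (Fin n) → ℝ,
      ∫ x, m x * (p x * q x) = ∫ x in B, m x * p x * q x := fun p q => by
    rw [setIntegral_eq_integral_of_forall_compl_eq_zero fun x hx => by simp [hB x hx]]
    simp only [mul_assoc]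
  obtain ⟨C, hC⟩ := hc.exists_bound_of_continuous hm
  simp only [e]
  exact tendsto_integral_mul_of_tendsto_eLpNorm (fun k => memLp_bdd_mul hm hc (ha.1 k))
    (memLp_bdd_mul hm hc ha.2.1) hb.1 hb.2.1 (tendsto_eLpNorm_bdd_mul hC ha.2.2) hb.2.2

theorem integrable_mul_mul (hm : Continuous m) (hc : HasCompactSupport m)
    (hf : MemLp f 2) (hg : MemLp g 2) : Integrable fun x => m x * (f x * g x) := by
  refine ((memLp_bdd_mul hm hc hf).integrable_mul hg).congr (Eventually.of_forall fun x => ?_)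
  exact mul_assoc _ _ _

theorem tendstoL2On_smear (hf : MemLp f 2) :
    TendstoL2On B (fun k => smear (mollifier n k) f) f :=
  ⟨fun k => (memLp_smear (contDiff_mollifier k) (hasCompactSupport_mollifier k)
      (mollifier_nonneg k) (integral_mollifier k) hf).restrict B, hf.restrict B,
    tendsto_of_tendsto_of_tendsto_of_le_of_le tendsto_const_nhds (tendsto_eLpNorm_smear_sub hf)
      (fun _ => zero_le) fun _ => eLpNorm_mono_measure _ Measure.restrict_le_self⟩

theorem tendstoL2On_const (hB : Bornology.IsBounded B) (c : ℝ) :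
    TendstoL2On B (fun _ _ => c) (fun _ => c) := by
  have : IsFiniteMeasure (volume.restrict B) := ⟨by simpa using hB.measure_lt_top⟩
  exact ⟨fun _ => memLp_const c, memLp_const c, by simp⟩

/-- The negative part is 1-Lipschitz and `G k` is uniformly `δ k`-close to it, so the error is at
most `|a k - f| + δ k`. Boundedness of `B` puts the constant `δ k` in `L²(B)`. -/
theorem TendstoL2On.of_abs_sub_le (ha : TendstoL2On B a f) (hB : Bornology.IsBounded B)
    {G : ℕ → ℝ → ℝ} (hG : ∀ k, Continuous (G k)) {δ : ℕ → ℝ} (hδ : Tendsto δ atTop (𝓝 0))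
    (hGδ : ∀ k s, |G k s - max (-s) 0| ≤ δ k) :
    TendstoL2On B (fun k x => G k (a k x)) (fun x => max (-f x) 0) := by
  have : IsFiniteMeasure (volume.restrict B) := ⟨by simpa using hB.measure_lt_top⟩
  have hδ0 : ∀ k, 0 ≤ δ k := fun k => (abs_nonneg _).trans (hGδ k 0)
  have hf : MemLp (fun x => max (-f x) 0) 2 (volume.restrict B) :=
    ha.2.1.neg.of_le ((ha.2.1.1.neg.sup aestronglyMeasurable_const)) (Eventually.of_forall fun x => by
      simp only [Real.norm_eq_abs, Pi.neg_apply, abs_neg]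
      rw [abs_of_nonneg (le_max_right _ _)]
      exact max_le (neg_le_abs _) (abs_nonneg _))
  have hdiff : ∀ k x, ‖G k (a k x) - max (-f x) 0‖ ≤ ‖|a k x - f x| + δ k‖ := fun k x => by
    have h1 := hGδ k (a k x)
    have h2 := abs_max_sub_max_le_abs (-a k x) (-f x) 0
    have h3 : |(-a k x) - (-f x)| = |a k x - f x| := by rw [← abs_neg]; congr 1; ring
    rw [Real.norm_eq_abs, Real.norm_of_nonneg (add_nonneg (abs_nonneg _) (hδ0 k))]
    calc _ = |(max (-a k x) 0 - max (-f x) 0) + (G k (a k x) - max (-a k x) 0)| := by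
          congr 1; ring
      _ ≤ _ := (abs_add_le _ _).trans (by linarith)
  have hmd : ∀ k, AEStronglyMeasurable (fun x => G k (a k x)) (volume.restrict B) := fun k =>
    (hG k).comp_aestronglyMeasurable (ha.1 k).1
  have habs : ∀ k, MemLp (fun x => |a k x - f x|) 2 (volume.restrict B) := fun k =>
    ((ha.1 k).sub ha.2.1).abs
  have hd : ∀ k, MemLp (fun x => G k (a k x) - max (-f x) 0) 2 (volume.restrict B) := fun k =>
    ((habs k).add (memLp_const (δ k))).of_le ((hmd k).sub hf.1) (Eventually.of_forall (hdiff k))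
  refine ⟨fun k => ?_, hf, ?_⟩
  · have := (hd k).add hf
    exact (memLp_congr_ae (Eventually.of_forall fun x => by simp)).1 this
  · have hlim : Tendsto (fun k => eLpNorm (a k - f) 2 (volume.restrict B) +
        eLpNorm (fun _ : EuclideanSpace ℝ (Fin n) => δ k) 2 (volume.restrict B)) atTop (𝓝 0) := by
      have h2 : Tendsto (fun k => eLpNorm (fun _ : EuclideanSpace ℝ (Fin n) => δ k) 2
          (volume.restrict B)) atTop (𝓝 0) := by
        simp only [eLpNorm_const' _ two_ne_zero ENNReal.ofNat_ne_top]
        have h3 : Tendsto (fun k => ‖δ k‖ₑ) atTop (𝓝 0) := by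
          simpa using hδ.enorm
        simpa using ENNReal.Tendsto.mul_const h3 (b := (volume.restrict B) Set.univ ^
          (1 / ENNReal.toReal 2)) (Or.inr (by
            exact ENNReal.rpow_ne_top_of_nonneg (by positivity) (measure_ne_top _ _)))
      simpa using ha.2.2.add h2
    refine tendsto_of_tendsto_of_tendsto_of_le_of_le tendsto_const_nhds hlim (fun _ => zero_le)
      fun k => ?_
    refine (eLpNorm_mono (hdiff k)).trans ((eLpNorm_add_le (habs k).1 aestronglyMeasurable_const
      (by norm_num)).trans ?_)
    gcongr
    exact (eLpNorm_norm (a k - f)).le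

end LocalL2

/-! ### The differential expression in components. -/

section System

open Filter Topology

variable {n d : ℕ}

/-- The `i`-th component of `-Δφ + Vφ`. -/
noncomputable def schrodingerComp (V : EuclideanSpace ℝ (Fin n) → Matrix (Fin d) (Fin d) ℝ)
    (φ : Fin d → EuclideanSpace ℝ (Fin n) → ℝ) (i : Fin d) : EuclideanSpace ℝ (Fin n) → ℝ :=
  fun x => -lap (φ i) x + ∑ j, V x i j * φ j x

variable {V : EuclideanSpace ℝ (Fin n) → Matrix (Fin d) (Fin d) ℝ}
  {φ : Fin d → EuclideanSpace ℝ (Fin n) → ℝ}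

theorem continuous_schrodingerComp (hV : ∀ i j, Continuous fun x => V x i j)
    (hφ : ∀ i, ContDiff ℝ ∞ (φ i)) (i : Fin d) : Continuous (schrodingerComp V φ i) :=
  (hφ i).lap.continuous.neg.add
    (continuous_finsetSum _ fun j _ => (hV i j).mul (hφ j).continuous)

theorem schrodingerComp_eq_zero {x : EuclideanSpace ℝ (Fin n)}
    (hx : ∀ i, x ∉ tsupport (φ i)) (i : Fin d) : schrodingerComp V φ i x = 0 := by
  have h1 : lap (φ i) x = 0 :=
    image_eq_zero_of_notMem_tsupport fun h => hx i (tsupport_lap_subset h)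
  simp [schrodingerComp, h1, image_eq_zero_of_notMem_tsupport (hx _)]

theorem hasCompactSupport_schrodingerComp (hc : ∀ i, HasCompactSupport (φ i)) (i : Fin d) :
    HasCompactSupport (schrodingerComp V φ i) := by
  refine HasCompactSupport.of_support_subset_isCompact
    (isCompact_iUnion fun i => (hc i).isCompact) fun x hx => ?_
  by_contra h
  exact hx (schrodingerComp_eq_zero (fun i hi => h (Set.mem_iUnion.2 ⟨i, hi⟩)) i)

/-- Testing with a function concentrated in component `i` isolates the `i`-th weak equation. Duality
transposes the coupling, whence `V x j i`; symmetry of `V` is never needed. -/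
theorem sum_integral_mul_schrodingerComp_single (hV : ∀ i j, Continuous fun x => V x i j)
    {v : Fin d → EuclideanSpace ℝ (Fin n) → ℝ} (hv : ∀ i, LocallyIntegrable (v i))
    {ψ : EuclideanSpace ℝ (Fin n) → ℝ} (hψ : ContDiff ℝ ∞ ψ) (hc : HasCompactSupport ψ)
    (i : Fin d) :
    ∑ j, ∫ x, v j x * schrodingerComp V (Pi.single i ψ) j x =
      (∫ x, (∑ j, V x j i * v j x) * ψ x) - ∫ x, v i x * lap ψ x := by
  have e : ∀ j x, v j x * schrodingerComp V (Pi.single i ψ) j x =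
      v j x * (V x j i * ψ x) - if j = i then v i x * lap ψ x else 0 := fun j x => by
    have h1 : ∑ l, V x j l * (Pi.single i ψ : Fin d → EuclideanSpace ℝ (Fin n) → ℝ) l x =
        V x j i * ψ x := by
      rw [Finset.sum_eq_single i (fun l _ hl => by rw [Pi.single_eq_of_ne hl]; simp) (by simp),
        Pi.single_eq_same]
    rw [schrodingerComp, h1]
    split_ifs with hj
    · subst hj; rw [Pi.single_eq_same]; ring
    · rw [Pi.single_eq_of_ne hj, show (0 : EuclideanSpace ℝ (Fin n) → ℝ) = fun _ => 0 from rfl,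
        lap_zero]
      simp
  have i1 : ∀ j, Integrable fun x => v j x * (V x j i * ψ x) := fun j =>
    (hv j).integrable_mul ((hV j i).mul hψ.continuous) hc.mul_left
  have i2 : Integrable fun x => v i x * lap ψ x := (hv i).integrable_mul hψ.lap.continuous hc.lap
  have i3 : ∀ j, Integrable fun x => if j = i then v i x * lap ψ x else 0 := fun j => by
    split_ifs
    · exact i2
    · exact integrable_zero _ _ _
  have e2 : ∀ x, (∑ j, V x j i * v j x) * ψ x = ∑ j, v j x * (V x j i * ψ x) := fun x => by
    rw [Finset.sum_mul]; exact Finset.sum_congr rfl fun j _ => by ring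
  have s1 : ∫ x, (∑ j, V x j i * v j x) * ψ x = ∑ j, ∫ x, v j x * (V x j i * ψ x) := by
    simp only [e2]
    exact integral_finsetSum _ fun j _ => i1 j
  have s2 : ∀ j, ∫ x, v j x * schrodingerComp V (Pi.single i ψ) j x =
      (∫ x, v j x * (V x j i * ψ x)) - ∫ x, if j = i then v i x * lap ψ x else 0 := fun j => by
    simp only [e]
    exact integral_sub (i1 j) (i3 j)
  simp only [s1, s2, Finset.sum_sub_distrib]
  congr 1
  rw [Finset.sum_eq_single i (fun j _ hj => by simp [hj]) (by simp)]
  simp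

end System

/-! ### The energy inequality for the softened negative part and its limit. -/

section Energy

open Filter Topology

variable {n d : ℕ} {V : EuclideanSpace ℝ (Fin n) → Matrix (Fin d) (Fin d) ℝ}

theorem HasCompactSupport.sq {χ : EuclideanSpace ℝ (Fin n) → ℝ} (hc : HasCompactSupport χ) :
    HasCompactSupport fun x => χ x ^ 2 := by
  simp only [pow_two]
  exact hc.mul_right

/-- The energy of the truncated softened negative part is controlled through convexity. -/
theorem sum_integral_energy_le (hV : ∀ i j, Continuous fun x => V x i j)
    {χ : EuclideanSpace ℝ (Fin n) → ℝ} (hχ : ContDiff ℝ ∞ χ) (hc : HasCompactSupport χ)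
    {w : Fin d → EuclideanSpace ℝ (Fin n) → ℝ} (hw : ∀ i, ContDiff ℝ ∞ (w i)) {δ : ℝ}
    (hδ : 0 < δ) :
    ∑ i, ∫ x, schrodingerComp V (fun i x => χ x * softNeg δ (w i x)) i x *
        (χ x * softNeg δ (w i x)) ≤
      ∑ i, (∫ x, gradSq χ x * (softNeg δ (w i x) * softNeg δ (w i x))) +
      ∑ i, (∫ x, χ x ^ 2 * (-(softNeg δ (w i x) * deriv (softNeg δ) (w i x)) * lap (w i) x)) +
      ∑ i, ∑ j, ∫ x, (χ x ^ 2 * V x i j) * (softNeg δ (w i x) * softNeg δ (w j x)) := by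
  rw [← Finset.sum_add_distrib, ← Finset.sum_add_distrib]
  refine Finset.sum_le_sum fun i _ => ?_
  have hg := contDiff_softNeg hδ
  have hd : Continuous (deriv (softNeg δ)) := hg.continuous_deriv (by simp)
  have hv : ∀ i, ContDiff ℝ ∞ fun x => softNeg δ (w i x) := fun i => hg.comp (hw i)
  have hψ : ∀ i, ContDiff ℝ ∞ fun x => χ x * softNeg δ (w i x) := fun i => hχ.mul (hv i)
  have e : ∀ x, schrodingerComp V (fun i x => χ x * softNeg δ (w i x)) i x *
      (χ x * softNeg δ (w i x)) =
      (χ x * softNeg δ (w i x)) * -lap (fun x => χ x * softNeg δ (w i x)) x +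
      ∑ j, (χ x ^ 2 * V x i j) * (softNeg δ (w i x) * softNeg δ (w j x)) := fun x => by
    rw [schrodingerComp, add_mul, Finset.sum_mul]
    congr 1
    · ring
    · exact Finset.sum_congr rfl fun j _ => by ring
  have i1 : Integrable fun x =>
      (χ x * softNeg δ (w i x)) * -lap (fun x => χ x * softNeg δ (w i x)) x :=
    ((hψ i).continuous.mul (hψ i).lap.continuous.neg).integrable_of_hasCompactSupport
      (hc.mul_right.mul_right)
  have i2 : ∀ j, Integrable fun x =>
      (χ x ^ 2 * V x i j) * (softNeg δ (w i x) * softNeg δ (w j x)) := fun j =>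
    (((hχ.continuous.pow 2).mul (hV i j)).mul
      ((hv i).continuous.mul (hv j).continuous)).integrable_of_hasCompactSupport
      hc.sq.mul_right.mul_right
  have i3 : Integrable fun x => gradSq χ x * (softNeg δ (w i x) * softNeg δ (w i x)) :=
    (hχ.gradSq.continuous.mul
      ((hv i).continuous.mul (hv i).continuous)).integrable_of_hasCompactSupport
      (hasCompactSupport_gradSq hc).mul_right
  have i4 : Integrable fun x =>
      χ x ^ 2 * (-(softNeg δ (w i x) * deriv (softNeg δ) (w i x)) * lap (w i) x) :=
    ((hχ.continuous.pow 2).mul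
      (((hv i).continuous.mul (hd.comp (hw i).continuous)).neg.mul
        (hw i).lap.continuous)).integrable_of_hasCompactSupport hc.sq.mul_right
  have i5 : Integrable fun x => χ x ^ 2 * softNeg δ (w i x) * -lap (fun x => softNeg δ (w i x)) x :=
    (((hχ.continuous.pow 2).mul (hv i).continuous).mul
      (hv i).lap.continuous.neg).integrable_of_hasCompactSupport hc.sq.mul_right.mul_right
  simp only [e]
  rw [integral_add i1 (integrable_finsetSum _ fun j _ => i2 j),
    integral_cutoff_mul_neg_lap hχ (hv i) hc, integral_finsetSum _ fun j _ => i2 j]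
  gcongr
  rw [← integral_add i3 i4]
  refine integral_mono ((i3.add i5).congr (Eventually.of_forall fun x => by
    simp only [Pi.add_apply]; ring))
    (i3.add i4) fun x => ?_
  simp only
  rw [lap_comp hg (hw i)]
  -- The discarded term is `-χ² g g'' |∇w|²` with `g = softNeg δ`, nonpositive by convexity. No
  -- gradient of `w` survives.
  have := mul_nonneg (mul_nonneg (sq_nonneg (χ x)) (softNeg_pos hδ (w i x)).le)
    (mul_nonneg (deriv_deriv_softNeg_nonneg hδ (w i x)) (gradSq_nonneg (f := w i) x))
  linarith

/-- The kernels have radius at most `1`, so only values on the unit ball around `x` matter. There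
`f`, which may be only locally in `L²`, can be exchanged for a globally `L²` function `F`. -/
theorem lap_smear_mollifier {u f F : EuclideanSpace ℝ (Fin n) → ℝ} (hu : LocallyIntegrable u)
    {B : Set (EuclideanSpace ℝ (Fin n))} (hF : ∀ x ∈ B, F x = f x)
    (h : ∀ φ : EuclideanSpace ℝ (Fin n) → ℝ, ContDiff ℝ ∞ φ → HasCompactSupport φ →
      ∫ x, u x * lap φ x = -∫ x, f x * φ x) (k : ℕ) {x : EuclideanSpace ℝ (Fin n)}
    (hx : Metric.closedBall x 1 ⊆ B) :
    lap (smear (mollifier n k) u) x = -smear (mollifier n k) F x := by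
  have := h _ (contDiff_reflect (contDiff_mollifier k) x)
    (hasCompactSupport_reflect (hasCompactSupport_mollifier k) x)
  rw [lap_reflect (contDiff_mollifier k)] at this
  rw [lap_smear (contDiff_mollifier k) (hasCompactSupport_mollifier k) hu]
  simp only [smear]
  simp only [mul_comm (u _)] at this
  rw [this]
  congr 2
  ext y
  rw [mul_comm]
  by_cases hy : y ∈ Metric.closedBall x 1
  · rw [hF y (hx hy)]
  · rw [mollifier_reflect_eq_zero, zero_mul, zero_mul]
    rw [Metric.mem_closedBall, not_le] at hy
    refine lt_of_le_of_lt ?_ hy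
    rw [div_le_one (by positivity)]
    simp

/-- Passing to the limit in the energy inequality. -/
theorem energy_limit (hV : ∀ i j, Continuous fun x => V x i j)
    {u f F : Fin d → EuclideanSpace ℝ (Fin n) → ℝ} (hu : ∀ i, MemLp (u i) 2)
    (hF : ∀ i, MemLp (F i) 2) {R : ℝ} (hFf : ∀ i, ∀ x ∈ Metric.closedBall 0 (R + 1), F i x = f i x)
    (hweak : ∀ i, ∀ φ : EuclideanSpace ℝ (Fin n) → ℝ, ContDiff ℝ ∞ φ → HasCompactSupport φ →
      ∫ x, u i x * lap φ x = -∫ x, f i x * φ x)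
    {φ : Fin d → EuclideanSpace ℝ (Fin n) → ℝ} (hφ : ∀ i, ContDiff ℝ ∞ (φ i))
    (hφc : ∀ i, HasCompactSupport (φ i)) {t q : ℝ}
    (hpos : ∀ ψ : Fin d → EuclideanSpace ℝ (Fin n) → ℝ, (∀ i, ContDiff ℝ ∞ (ψ i)) →
      (∀ i, HasCompactSupport (ψ i)) → 0 ≤ ∑ i, (∫ x, schrodingerComp V ψ i x * ψ i x) +
        2 * t * ∑ i, (∫ x, ψ i x * schrodingerComp V φ i x) + t ^ 2 * q)
    {χ : EuclideanSpace ℝ (Fin n) → ℝ} (hχ : ContDiff ℝ ∞ χ)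
    (hχs : tsupport χ ⊆ Metric.closedBall 0 R) (hχ1 : ∀ i, ∀ x ∈ tsupport (φ i), χ x = 1) :
    0 ≤ ∑ i, (∫ x, gradSq χ x * (max (-u i x) 0 * max (-u i x) 0)) +
      ∑ i, (∫ x, -χ x ^ 2 * (max (-u i x) 0 * F i x)) +
      ∑ i, ∑ j, (∫ x, (χ x ^ 2 * V x i j) * (max (-u i x) 0 * max (-u j x) 0)) +
      2 * t * ∑ i, (∫ x, schrodingerComp V φ i x * (max (-u i x) 0 * 1)) + t ^ 2 * q := by
  have hc : HasCompactSupport χ :=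
    (isCompact_closedBall (0 : EuclideanSpace ℝ (Fin n)) R).of_isClosed_subset
      (isClosed_tsupport χ) hχs
  set B : Set (EuclideanSpace ℝ (Fin n)) := Metric.closedBall 0 R with hB
  have hBb : Bornology.IsBounded B := Metric.isBounded_closedBall
  have hχB : ∀ x ∉ B, χ x = 0 := fun x hx => image_eq_zero_of_notMem_tsupport fun h => hx (hχs h)
  have hgB : ∀ x ∉ B, gradSq χ x = 0 := fun x hx => Finset.sum_eq_zero fun i _ => by
    rw [image_eq_zero_of_notMem_tsupport fun h' => hx (hχs (tsupport_pd_subset i h'))]; simp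
  have hcomp : ∀ i x, x ∉ B → schrodingerComp V φ i x = 0 := fun i x hx =>
    schrodingerComp_eq_zero (fun j hj => by
      have h1 := hχ1 j x hj
      rw [hχB x hx] at h1
      exact zero_ne_one h1) i
  set δ : ℕ → ℝ := fun k => 1 / (k + 1) with hδ
  have hδ0 : ∀ k, 0 < δ k := fun k => by positivity
  have hδt : Tendsto δ atTop (𝓝 0) := tendsto_one_div_add_atTop_nhds_zero_nat
  have hn : ∀ i, TendstoL2On B (fun k x => softNeg (δ k) (smear (mollifier n k) (u i) x))
      (fun x => max (-u i x) 0) := fun i =>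
    (tendstoL2On_smear (hu i)).of_abs_sub_le hBb (fun k => (contDiff_softNeg (hδ0 k)).continuous) hδt
      fun k => abs_softNeg_sub_negPart_le (hδ0 k)
  have hG : ∀ i, TendstoL2On B (fun k x => -(softNeg (δ k) (smear (mollifier n k) (u i) x) *
      deriv (softNeg (δ k)) (smear (mollifier n k) (u i) x))) (fun x => max (-u i x) 0) := fun i =>
    (tendstoL2On_smear (hu i)).of_abs_sub_le hBb
      (G := fun k s => -(softNeg (δ k) s * deriv (softNeg (δ k)) s))
      (fun k => ((contDiff_softNeg (hδ0 k)).continuous.mul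
        ((contDiff_softNeg (hδ0 k)).continuous_deriv (by simp))).neg) hδt
      fun k => abs_neg_softNeg_mul_deriv_sub_negPart_le (hδ0 k)
  have hχ2 : Continuous fun x => χ x ^ 2 := hχ.continuous.pow 2
  have hnχ2 : Continuous fun x => -χ x ^ 2 := hχ2.neg
  have hcn : HasCompactSupport fun x => -χ x ^ 2 := hc.sq.neg
  have hχ2B : ∀ x ∉ B, -χ x ^ 2 = 0 := fun x hx => by rw [hχB x hx]; norm_num
  have hχVB : ∀ i j, ∀ x ∉ B, χ x ^ 2 * V x i j = 0 := fun i j x hx => by rw [hχB x hx]; norm_num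
  have hcχV : ∀ i j, Continuous fun x => χ x ^ 2 * V x i j := fun i j => hχ2.mul (hV i j)
  have hcV : ∀ i j, HasCompactSupport fun x => χ x ^ 2 * V x i j := fun i j =>
    hc.sq.mul_right (f' := fun x => V x i j)
  have T1 := fun i => (hn i).integral (hn i) hχ.gradSq.continuous (hasCompactSupport_gradSq hc) hgB
  have T2 := fun i => (hG i).integral (tendstoL2On_smear (hF i)) hnχ2 hcn hχ2B
  have T3 := fun i j => (hn i).integral (hn j) (hcχV i j) (hcV i j) (hχVB i j)
  have T4 := fun i => (hn i).integral (tendstoL2On_const hBb 1)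
    (continuous_schrodingerComp hV hφ i) (hasCompactSupport_schrodingerComp hφc i) (hcomp i)
  have S1 := tendsto_finsetSum Finset.univ fun i _ => T1 i
  have S2 := tendsto_finsetSum Finset.univ fun i _ => T2 i
  have S3 := tendsto_finsetSum Finset.univ fun i _ => tendsto_finsetSum Finset.univ fun j _ => T3 i j
  have S4 := (tendsto_finsetSum Finset.univ fun i _ => T4 i).const_mul (2 * t)
  refine ge_of_tendsto ((((S1.add S2).add S3).add S4).add_const (t ^ 2 * q))
    (Eventually.of_forall fun k => ?_)
  clear S1 S2 S3 S4 T1 T2 T3 T4 hn hG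
  have hws : ∀ i, ContDiff ℝ ∞ (smear (mollifier n k) (u i)) := fun i =>
    (contDiff_mollifier k).smear (hasCompactSupport_mollifier k)
      ((hu i).locallyIntegrable (by norm_num))
  have E := sum_integral_energy_le hV hχ hc hws (hδ0 k)
  have P := hpos (fun i x => χ x * softNeg (δ k) (smear (mollifier n k) (u i) x))
    (fun i => hχ.mul ((contDiff_softNeg (hδ0 k)).comp (hws i))) (fun i => hc.mul_right)
  have r2 : ∀ i, ∫ x, χ x ^ 2 * (-(softNeg (δ k) (smear (mollifier n k) (u i) x) *
      deriv (softNeg (δ k)) (smear (mollifier n k) (u i) x)) *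
        lap (smear (mollifier n k) (u i)) x) =
      ∫ x, -χ x ^ 2 * (-(softNeg (δ k) (smear (mollifier n k) (u i) x) *
      deriv (softNeg (δ k)) (smear (mollifier n k) (u i) x)) *
        smear (mollifier n k) (F i) x) := fun i => by
    congr 1
    ext x
    by_cases hx : x ∈ B
    · rw [lap_smear_mollifier ((hu i).locallyIntegrable (by norm_num)) (hFf i) (hweak i) k
        (x := x) fun y hy => ?_]
      · ring
      · rw [hB, mem_closedBall_zero_iff] at hx
        rw [Metric.mem_closedBall] at hy ⊢
        have := dist_triangle y x 0
        rw [dist_zero_right x] at this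
        linarith
    · simp [hχB x hx]
  -- The cutoff drops out of the cross term because `χ = 1` wherever some `φ j` lives.
  have r4 : ∀ i, ∫ x, χ x * softNeg (δ k) (smear (mollifier n k) (u i) x) *
      schrodingerComp V φ i x =
      ∫ x, schrodingerComp V φ i x * (softNeg (δ k) (smear (mollifier n k) (u i) x) * 1) := fun i => by
    congr 1
    ext x
    by_cases hx : ∃ j, x ∈ tsupport (φ j)
    · obtain ⟨j, hj⟩ := hx
      rw [hχ1 j x hj]; ring
    · rw [schrodingerComp_eq_zero (not_exists.1 hx)]; ring
  simp only [r2] at E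
  simp only [r4] at P
  linarith

end Energy

/-! ### The negative part solves the homogeneous system. -/

section NegPart

open Filter Topology

variable {n d : ℕ} {V : EuclideanSpace ℝ (Fin n) → Matrix (Fin d) (Fin d) ℝ}

theorem MeasureTheory.MemLp.negPart_max {u : EuclideanSpace ℝ (Fin n) → ℝ} (hu : MemLp u 2) :
    MemLp (fun x => max (-u x) 0) 2 := by
  refine hu.of_le (hu.1.neg.sup aestronglyMeasurable_const) (Eventually.of_forall fun x => ?_)
  rw [Real.norm_eq_abs, Real.norm_eq_abs, abs_of_nonneg (le_max_right _ _)]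
  exact max_le (neg_le_abs _) (abs_nonneg _)

/-- Since `u + u⁻ = u⁺`, the sum equals `-∑ uᵢ⁻ eᵢ + ∑ A j i uᵢ⁻ uⱼ⁺`. The diagonal terms vanish as
`uᵢ⁻ uᵢ⁺ = 0`, and the others have the sign of the off-diagonal entries. -/
theorem coupling_negPart_nonpos {A : Matrix (Fin d) (Fin d) ℝ} (hA : ∀ i j, i ≠ j → A i j ≤ 0)
    {e : Fin d → ℝ} (he : ∀ i, 0 ≤ e i) (u : Fin d → ℝ) :
    ∑ i, -(max (-u i) 0 * (e i - ∑ j, A j i * u j)) +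
      ∑ i, ∑ j, A i j * (max (-u i) 0 * max (-u j) 0) ≤ 0 := by
  rw [Finset.sum_comm (f := fun i j => A i j * (max (-u i) 0 * max (-u j) 0)),
    ← Finset.sum_add_distrib]
  refine Finset.sum_nonpos fun i _ => ?_
  have h1 : ∑ j, (A j i * (max (-u i) 0 * (u j + max (-u j) 0))) ≤ 0 := by
    refine Finset.sum_nonpos fun j _ => ?_
    have h3 : 0 ≤ u j + max (-u j) 0 := by linarith [le_max_left (-u j) 0]
    rcases eq_or_ne j i with rfl | h
    · have : max (-u j) 0 * (u j + max (-u j) 0) = 0 := by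
        rcases le_total 0 (u j) with h | h
        · rw [max_eq_right (by linarith)]; ring
        · rw [max_eq_left (by linarith)]; ring
      rw [this, mul_zero]
    · exact mul_nonpos_of_nonpos_of_nonneg (hA j i h) (mul_nonneg (le_max_right _ _) h3)
  have h2 : 0 ≤ max (-u i) 0 * e i := mul_nonneg (le_max_right _ _) (he i)
  have h3 : ∑ j, (A j i * (max (-u i) 0 * (u j + max (-u j) 0))) =
      max (-u i) 0 * ∑ j, A j i * u j + ∑ j, A j i * (max (-u j) 0 * max (-u i) 0) := by
    rw [Finset.mul_sum, ← Finset.sum_add_distrib]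
    exact Finset.sum_congr rfl fun j _ => by ring
  linarith

/-- A family of cutoff functions with small gradients. -/
theorem exists_cutoff (n : ℕ) : ∃ C : ℝ, 0 ≤ C ∧ ∀ R : ℝ, 0 < R →
    ∃ χ : EuclideanSpace ℝ (Fin n) → ℝ, ContDiff ℝ ∞ χ ∧
      tsupport χ ⊆ Metric.closedBall 0 (2 * R) ∧ (∀ x ∈ Metric.closedBall 0 R, χ x = 1) ∧
      ∀ x, gradSq χ x ≤ C / R ^ 2 := by
  set b : ContDiffBump (0 : EuclideanSpace ℝ (Fin n)) := ⟨1, 2, one_pos, one_lt_two⟩ with hb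
  have hbs : ContDiff ℝ ∞ (b : EuclideanSpace ℝ (Fin n) → ℝ) := b.contDiff
  obtain ⟨C, hC⟩ := (hasCompactSupport_gradSq b.hasCompactSupport).exists_bound_of_continuous
    hbs.gradSq.continuous
  refine ⟨C, (norm_nonneg _).trans (hC 0), fun R hR => ⟨fun x => b (0 + R⁻¹ • x),
    hbs.comp (contDiff_const.add (contDiff_id.const_smul _)), ?_, fun x hx => ?_, fun x => ?_⟩⟩
  · refine closure_minimal (fun x hx => ?_) Metric.isClosed_closedBall
    have := b.support_eq ▸ (show (0 + R⁻¹ • x) ∈ Function.support b from hx)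
    rw [zero_add, mem_ball_zero_iff, norm_smul, norm_inv, Real.norm_of_nonneg hR.le,
      inv_mul_lt_iff₀ hR] at this
    rw [mem_closedBall_zero_iff]
    have h2 : b.rOut = 2 := rfl
    rw [h2] at this
    linarith
  · refine b.one_of_mem_closedBall ?_
    rw [mem_closedBall_zero_iff] at hx ⊢
    rw [zero_add, norm_smul, norm_inv, Real.norm_of_nonneg hR.le, inv_mul_le_iff₀ hR]
    have h2 : b.rIn = 1 := rfl
    rw [h2]
    linarith
  · have h1 : gradSq (fun x => b (0 + R⁻¹ • x)) x = gradSq b (0 + R⁻¹ • x) / R ^ 2 := by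
      simp only [gradSq, pd_comp_add_smul hbs, Finset.sum_div]
      refine Finset.sum_congr rfl fun i _ => ?_
      field_simp
    rw [h1]
    gcongr
    exact (le_abs_self _).trans (hC _)

/-- Dropping the terms with a favourable sign in the limit energy inequality. -/
theorem energy_gradSq_nonneg (hV : ∀ i j, Continuous fun x => V x i j)
    (hV_off : ∀ i j, i ≠ j → ∀ x, V x i j ≤ 0)
    {u η : Fin d → EuclideanSpace ℝ (Fin n) → ℝ} (hu : ∀ i, MemLp (u i) 2)
    (hη : ∀ i, MemLp (η i) 2) (hη0 : ∀ᵐ x, ∀ i, 0 ≤ η i x)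
    (hweak : ∀ i, ∀ φ : EuclideanSpace ℝ (Fin n) → ℝ, ContDiff ℝ ∞ φ → HasCompactSupport φ →
      ∫ x, u i x * lap φ x = -∫ x, (η i x - ∑ j, V x j i * u j x) * φ x)
    {φ : Fin d → EuclideanSpace ℝ (Fin n) → ℝ} (hφ : ∀ i, ContDiff ℝ ∞ (φ i))
    (hφc : ∀ i, HasCompactSupport (φ i)) {t q : ℝ}
    (hpos : ∀ ψ : Fin d → EuclideanSpace ℝ (Fin n) → ℝ, (∀ i, ContDiff ℝ ∞ (ψ i)) →
      (∀ i, HasCompactSupport (ψ i)) → 0 ≤ ∑ i, (∫ x, schrodingerComp V ψ i x * ψ i x) +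
        2 * t * ∑ i, (∫ x, ψ i x * schrodingerComp V φ i x) + t ^ 2 * q)
    {χ : EuclideanSpace ℝ (Fin n) → ℝ} (hχ : ContDiff ℝ ∞ χ) {R : ℝ} (hR : 0 < R)
    (hχs : tsupport χ ⊆ Metric.closedBall 0 R) (hχ1 : ∀ i, ∀ x ∈ tsupport (φ i), χ x = 1) :
    0 ≤ ∑ i, (∫ x, gradSq χ x * (max (-u i x) 0 * max (-u i x) 0)) +
      2 * t * ∑ i, (∫ x, schrodingerComp V φ i x * max (-u i x) 0) + t ^ 2 * q := by
  have hc : HasCompactSupport χ :=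
    (isCompact_closedBall (0 : EuclideanSpace ℝ (Fin n)) R).of_isClosed_subset
      (isClosed_tsupport χ) hχs
  -- `V` may be unbounded, so the coupling is cut off to land in `L²`. The margin `R + 1` covers the
  -- mollifier radius around the support of `χ`.
  set θ : ContDiffBump (0 : EuclideanSpace ℝ (Fin n)) :=
    ⟨R + 1, R + 2, by linarith, by linarith⟩ with hθ
  have hθ1 : ∀ x ∈ Metric.closedBall (0 : EuclideanSpace ℝ (Fin n)) (R + 1), θ x = 1 :=
    fun x hx => θ.one_of_mem_closedBall hx
  set F : Fin d → EuclideanSpace ℝ (Fin n) → ℝ := fun i x =>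
    η i x - ∑ j, (θ x * V x j i) * u j x with hFdef
  have hF : ∀ i, MemLp (F i) 2 := fun i => (hη i).sub (memLp_finsetSum _ fun j _ =>
    memLp_bdd_mul (θ.continuous.mul (hV j i)) θ.hasCompactSupport.mul_right (hu j))
  have hFf : ∀ i, ∀ x ∈ Metric.closedBall 0 (R + 1), F i x = η i x - ∑ j, V x j i * u j x :=
    fun i x hx => by simp only [hFdef, hθ1 x hx, one_mul]
  have key := energy_limit hV hu hF hFf hweak hφ hφc hpos hχ hχs hχ1
  simp only [mul_one] at key
  have hn : ∀ i, MemLp (fun x => max (-u i x) 0) 2 := fun i => (hu i).negPart_max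
  have hχ2 : Continuous fun x => χ x ^ 2 := hχ.continuous.pow 2
  have i2 : ∀ i, Integrable fun x => -χ x ^ 2 * (max (-u i x) 0 * F i x) := fun i =>
    integrable_mul_mul hχ2.neg hc.sq.neg (hn i) (hF i)
  have i3 : ∀ i j, Integrable fun x => (χ x ^ 2 * V x i j) * (max (-u i x) 0 * max (-u j x) 0) :=
    fun i j => integrable_mul_mul (hχ2.mul (hV i j)) (hc.sq.mul_right (f' := fun x => V x i j))
      (hn i) (hn j)
  have e3 : ∀ i, ∑ j, (∫ x, (χ x ^ 2 * V x i j) * (max (-u i x) 0 * max (-u j x) 0)) =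
      ∫ x, ∑ j, (χ x ^ 2 * V x i j) * (max (-u i x) 0 * max (-u j x) 0) := fun i =>
    (integral_finsetSum _ fun j _ => i3 i j).symm
  have e4 : ∑ i, (∫ x, -χ x ^ 2 * (max (-u i x) 0 * F i x)) +
      ∑ i, ∑ j, (∫ x, (χ x ^ 2 * V x i j) * (max (-u i x) 0 * max (-u j x) 0)) =
      ∫ x, (∑ i, -χ x ^ 2 * (max (-u i x) 0 * F i x) +
        ∑ i, ∑ j, (χ x ^ 2 * V x i j) * (max (-u i x) 0 * max (-u j x) 0)) := by
    simp only [e3]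
    have s2 := integral_finsetSum Finset.univ fun i _ => i2 i
    have s3 := integral_finsetSum Finset.univ fun i _ =>
      integrable_finsetSum Finset.univ fun j _ => i3 i j
    have s4 := integral_add (integrable_finsetSum Finset.univ fun i _ => i2 i)
      (integrable_finsetSum Finset.univ fun i _ =>
        integrable_finsetSum Finset.univ fun j _ => i3 i j)
    rw [s2, s3] at s4
    exact s4.symm
  have e5 : ∫ x, (∑ i, -χ x ^ 2 * (max (-u i x) 0 * F i x) +
      ∑ i, ∑ j, (χ x ^ 2 * V x i j) * (max (-u i x) 0 * max (-u j x) 0)) ≤ 0 := by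
    refine integral_nonpos_of_ae ?_
    filter_upwards [hη0] with x hx
    by_cases hxB : x ∈ Metric.closedBall (0 : EuclideanSpace ℝ (Fin n)) R
    · have hx1 : x ∈ Metric.closedBall (0 : EuclideanSpace ℝ (Fin n)) (R + 1) :=
        Metric.closedBall_subset_closedBall (by linarith) hxB
      have h := mul_nonpos_of_nonneg_of_nonpos (sq_nonneg (χ x))
        (coupling_negPart_nonpos (fun i j hij => hV_off i j hij x) hx (fun i => u i x))
      simp only [Pi.zero_apply, hFf _ x hx1]
      refine le_of_eq_of_le ?_ h
      simp only [mul_add, Finset.mul_sum]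
      congr 1
      · exact Finset.sum_congr rfl fun i _ => by ring
      · exact Finset.sum_congr rfl fun i _ => Finset.sum_congr rfl fun j _ => by ring
    · have : χ x = 0 := image_eq_zero_of_notMem_tsupport fun h => hxB (hχs h)
      simp [this]
  linarith

/-- The negative part of a distributional supersolution of a nonnegative cooperative system is a
distributional solution of the homogeneous system. -/
theorem negPart_weak_solution (hV : ∀ i j, Continuous fun x => V x i j)
    (hV_off : ∀ i j, i ≠ j → ∀ x, V x i j ≤ 0)
    {u η : Fin d → EuclideanSpace ℝ (Fin n) → ℝ} (hu : ∀ i, MemLp (u i) 2)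
    (hη : ∀ i, MemLp (η i) 2) (hη0 : ∀ᵐ x, ∀ i, 0 ≤ η i x)
    (hweak : ∀ i, ∀ φ : EuclideanSpace ℝ (Fin n) → ℝ, ContDiff ℝ ∞ φ → HasCompactSupport φ →
      ∫ x, u i x * lap φ x = -∫ x, (η i x - ∑ j, V x j i * u j x) * φ x)
    {φ : Fin d → EuclideanSpace ℝ (Fin n) → ℝ} (hφ : ∀ i, ContDiff ℝ ∞ (φ i))
    (hφc : ∀ i, HasCompactSupport (φ i)) {q : ℝ}
    (hpos : ∀ t : ℝ, ∀ ψ : Fin d → EuclideanSpace ℝ (Fin n) → ℝ, (∀ i, ContDiff ℝ ∞ (ψ i)) →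
      (∀ i, HasCompactSupport (ψ i)) → 0 ≤ ∑ i, (∫ x, schrodingerComp V ψ i x * ψ i x) +
        2 * t * ∑ i, (∫ x, ψ i x * schrodingerComp V φ i x) + t ^ 2 * q) :
    ∑ i, (∫ x, schrodingerComp V φ i x * max (-u i x) 0) = 0 := by
  obtain ⟨C, hC0, hC⟩ := exists_cutoff n
  set b := ∑ i, (∫ x, schrodingerComp V φ i x * max (-u i x) 0) with hb
  set N := ∑ i, (∫ x, max (-u i x) 0 * max (-u i x) 0) with hN
  obtain ⟨R₀, hR₀⟩ := (isCompact_iUnion fun i => (hφc i).isCompact).isBounded.subset_closedBall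
    (0 : EuclideanSpace ℝ (Fin n))
  have hn : ∀ i, Integrable (fun x => max (-u i x) 0 * max (-u i x) 0) := fun i =>
    (hu i).negPart_max.integrable_mul (hu i).negPart_max
  have h1 : ∀ t : ℝ, ∀ R > max R₀ 0, 0 ≤ C / R ^ 2 * N + 2 * t * b + t ^ 2 * q := by
    intro t R hR
    have hR0 : 0 < R := (le_max_right _ _).trans_lt hR
    obtain ⟨χ, hχ, hχs, hχ1, hχg⟩ := hC R hR0
    have := energy_gradSq_nonneg hV hV_off hu hη hη0 hweak hφ hφc (hpos t) hχ (by positivity) hχs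
      (fun i x hx => hχ1 x (Metric.closedBall_subset_closedBall ((le_max_left _ _).trans hR.le)
        (hR₀ (Set.mem_iUnion.2 ⟨i, hx⟩))))
    have hc : HasCompactSupport χ :=
      (isCompact_closedBall (0 : EuclideanSpace ℝ (Fin n)) (2 * R)).of_isClosed_subset
        (isClosed_tsupport χ) hχs
    have hle : ∑ i, (∫ x, gradSq χ x * (max (-u i x) 0 * max (-u i x) 0)) ≤ C / R ^ 2 * N := by
      rw [hN, Finset.mul_sum]
      refine Finset.sum_le_sum fun i _ => ?_
      rw [← integral_const_mul]
      refine integral_mono (integrable_mul_mul hχ.gradSq.continuous (hasCompactSupport_gradSq hc)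
        (hu i).negPart_max (hu i).negPart_max) ((hn i).const_mul _) fun x => ?_
      exact mul_le_mul_of_nonneg_right (hχg x) (mul_self_nonneg _)
    linarith
  -- `R → ∞` with `t` fixed: the cutoff term is `O(R⁻²)` because the negative part is globally in
  -- `L²`.
  have h2 : ∀ t : ℝ, 0 ≤ 2 * t * b + t ^ 2 * q := by
    intro t
    have hlim : Tendsto (fun R : ℝ => C / R ^ 2 * N + 2 * t * b + t ^ 2 * q) atTop
        (𝓝 (0 * N + 2 * t * b + t ^ 2 * q)) :=
      ((((tendsto_const_nhds.div_atTop (tendsto_pow_atTop two_ne_zero)).mul_const N).add_const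
        _).add_const _)
    rw [zero_mul, zero_add] at hlim
    refine ge_of_tendsto hlim ?_
    filter_upwards [eventually_gt_atTop (max R₀ 0)] with R hR using h1 t R hR
  -- Replacing `q` by `|q| + 1 > 0` permits division; the minimum, at `s = -b/(|q| + 1)`, is
  -- `-b²/(|q| + 1)`, which forces `b = 0`.
  have h3 : ∀ s : ℝ, 0 ≤ 2 * s * b + s ^ 2 * (|q| + 1) := fun s => by
    have := h2 s
    nlinarith [le_abs_self q, sq_nonneg s]
  have hq : 0 < |q| + 1 := by positivity
  have h4 := h3 (-(b / (|q| + 1)))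
  have h5 : 2 * -(b / (|q| + 1)) * b + (-(b / (|q| + 1))) ^ 2 * (|q| + 1) =
      -(b ^ 2 / (|q| + 1)) := by field_simp; ring
  rw [h5] at h4
  have h6 : b ^ 2 / (|q| + 1) ≤ 0 := by linarith
  have h7 : b ^ 2 ≤ 0 := by
    by_contra h
    exact absurd h6 (not_le.2 (div_pos (not_le.1 h) hq))
  exact pow_eq_zero_iff two_ne_zero |>.1 (le_antisymm h7 (sq_nonneg b))

end NegPart

/-! ### The strong maximum principle for the system. -/

section CooperativeSystem

open Filter Topology

variable {n d : ℕ} {V : EuclideanSpace ℝ (Fin n) → Matrix (Fin d) (Fin d) ℝ}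

/-- The strong maximum principle for nonnegative distributional supersolutions of an irreducible
cooperative system. -/
theorem cooperative_strong_maximum_principle (hV : ∀ i j, Continuous fun x => V x i j)
    (hV_off : ∀ i j, i ≠ j → ∀ x, V x i j ≤ 0) (hV_irr : IrreducibleCoupling V)
    {v : Fin d → EuclideanSpace ℝ (Fin n) → ℝ} (hv : ∀ i, MemLp (v i) 2)
    (hv0 : ∀ i, 0 ≤ᵐ[volume] v i)
    (h : ∀ i, ∀ φ : EuclideanSpace ℝ (Fin n) → ℝ, ContDiff ℝ ∞ φ → HasCompactSupport φ →
      (∀ x, 0 ≤ φ x) → 0 ≤ (∫ x, (∑ j, V x j i * v j x) * φ x) - ∫ x, v i x * lap φ x) :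
    (∀ i, v i =ᵐ[volume] 0) ∨ ∀ i, ∀ K : Set (EuclideanSpace ℝ (Fin n)), IsCompact K →
      ∃ c : ℝ, 0 < c ∧ ∀ᵐ x ∂volume.restrict K, c ≤ v i x := by
  have hloc : ∀ i, LocallyIntegrable (v i) := fun i => (hv i).locallyIntegrable (by norm_num)
  have hae : ∀ᵐ x, ∀ i, 0 ≤ v i x := ae_all_iff.2 hv0
  have hint : ∀ i j, ∀ φ : EuclideanSpace ℝ (Fin n) → ℝ, Continuous φ → HasCompactSupport φ →
      Integrable fun x => V x j i * v j x * φ x := fun i j φ hφ hc => by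
    refine ((hloc j).integrable_mul ((hV j i).mul hφ) hc.mul_left).congr
      (Eventually.of_forall fun x => ?_)
    simp only [Pi.mul_apply]; ring
  have hscalar : ∀ i, v i =ᵐ[volume] 0 ∨ ∀ K : Set (EuclideanSpace ℝ (Fin n)), IsCompact K →
      ∃ c : ℝ, 0 < c ∧ ∀ᵐ x ∂volume.restrict K, c ≤ v i x := by
    intro i
    refine ae_eq_zero_or_locally_pos (hv i) (hv0 i) (hV i i) fun φ hφ hc hφ0 => ?_
    have i2 : Integrable fun x => v i x * lap φ x := (hloc i).integrable_mul hφ.lap.continuous hc.lap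
    have i1 := hint i i φ hφ.continuous hc
    have e1 : ∫ x, v i x * (V x i i * φ x - lap φ x) =
        (∫ x, V x i i * v i x * φ x) - ∫ x, v i x * lap φ x := by
      rw [← integral_sub i1 i2]
      congr 1; ext x; ring
    rw [e1]
    -- The off-diagonal terms are nonpositive, so each component alone is a supersolution with
    -- potential `V x i i`.
    refine (h i φ hφ hc hφ0).trans (sub_le_sub_right (integral_mono_ae ?_ i1 ?_) _)
    · simp only [Finset.sum_mul]
      exact integrable_finsetSum _ fun j _ => hint i j φ hφ.continuous hc
    · filter_upwards [hae] with x hx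
      refine mul_le_mul_of_nonneg_right ?_ (hφ0 x)
      rw [← Finset.add_sum_erase _ _ (Finset.mem_univ i)]
      have : ∑ j ∈ Finset.univ.erase i, V x j i * v j x ≤ 0 := Finset.sum_nonpos fun j hj =>
        mul_nonpos_of_nonpos_of_nonneg (hV_off j i (Finset.ne_of_mem_erase hj) x) (hx j)
      linarith
  by_cases hall : ∀ i, v i =ᵐ[volume] 0
  · exact Or.inl hall
  right
  by_contra hcon
  -- If some but not all components vanish, irreducibility yields `j` with `v j > 0` and `i` with `v
  -- i = 0` and `V x j i < 0`. The `i`-th inequality then reads `0 ≤ ∫ ∑ V x l i v l φ ≤ c ∫ V x j i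
  -- φ < 0`.
  set S : Set (Fin d) := {i | ¬ v i =ᵐ[volume] 0} with hS
  have hS1 : S.Nonempty := not_forall.1 hall
  have hS2 : Sᶜ.Nonempty := by
    by_contra hne
    rw [Set.not_nonempty_iff_eq_empty, Set.compl_empty_iff] at hne
    exact hcon fun i => (hscalar i).resolve_left (hne ▸ Set.mem_univ i : i ∈ S)
  obtain ⟨j, hj, i, hi, hneg⟩ := hV_irr S hS1 hS2
  have hvi : v i =ᵐ[volume] 0 := not_not.1 hi
  obtain ⟨c, hc, hcv⟩ := (hscalar j).resolve_left hj _
    (isCompact_closedBall (0 : EuclideanSpace ℝ (Fin n)) 1)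
  set φ : EuclideanSpace ℝ (Fin n) → ℝ := mollifier n 0 with hφ
  have hφs : ContDiff ℝ ∞ φ := contDiff_mollifier 0
  have hφc : HasCompactSupport φ := hasCompactSupport_mollifier 0
  have hle := h i φ hφs hφc (mollifier_nonneg 0)
  have hz : ∫ x, v i x * lap φ x = 0 := by
    refine integral_eq_zero_of_ae ?_
    filter_upwards [hvi] with x hx
    simp [hx]
  rw [hz, sub_zero] at hle
  have hbound : ∀ᵐ x, (∑ l, V x l i * v l x) * φ x ≤ V x j i * v j x * φ x := by
    filter_upwards [hae, hvi] with x hx hxi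
    refine mul_le_mul_of_nonneg_right ?_ (mollifier_nonneg 0 x)
    rw [← Finset.add_sum_erase _ _ (Finset.mem_univ j)]
    have : ∑ l ∈ Finset.univ.erase j, V x l i * v l x ≤ 0 := Finset.sum_nonpos fun l _ => by
      rcases eq_or_ne l i with rfl | hl
      · simp [hxi]
      · exact mul_nonpos_of_nonpos_of_nonneg (hV_off l i hl x) (hx l)
    linarith
  have h1 : 0 ≤ ∫ x, V x j i * v j x * φ x := hle.trans (integral_mono_ae (by
    simp only [Finset.sum_mul]
    exact integrable_finsetSum _ fun l _ => hint i l φ hφs.continuous hφc)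
    (hint i j φ hφs.continuous hφc) hbound)
  have hsup : ∀ x ∉ Metric.closedBall (0 : EuclideanSpace ℝ (Fin n)) 1, φ x = 0 := fun x hx =>
    image_eq_zero_of_notMem_tsupport fun h' => hx (by
      rw [hφ, tsupport_mollifier] at h'; simpa using h')
  have hci : Integrable fun x => c * V x j i * φ x :=
    ((continuous_const.mul (hV j i)).mul hφs.continuous).integrable_of_hasCompactSupport
      hφc.mul_left
  have h2 : ∫ x, V x j i * v j x * φ x ≤ ∫ x, c * V x j i * φ x := by
    refine integral_mono_ae (hint i j φ hφs.continuous hφc) hci ?_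
    filter_upwards [(ae_restrict_iff' Metric.isClosed_closedBall.measurableSet).1 hcv] with x hx
    by_cases hxB : x ∈ Metric.closedBall (0 : EuclideanSpace ℝ (Fin n)) 1
    · refine mul_le_mul_of_nonneg_right ?_ (mollifier_nonneg 0 x)
      rw [mul_comm c]
      exact mul_le_mul_of_nonpos_left (hx hxB) (hneg x).le
    · simp [hsup x hxB]
  obtain ⟨x₀, hx₀⟩ : ∃ x, φ x ≠ 0 := by
    by_contra hne
    push Not at hne
    have := integral_mollifier (n := n) 0
    rw [← hφ] at this
    simp [hne] at this
  have h3 : 0 < ∫ x, -(c * V x j i * φ x) := by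
    refine Continuous.integral_pos_of_hasCompactSupport_nonneg_nonzero
      ((continuous_const.mul (hV j i)).mul hφs.continuous).neg (HasCompactSupport.neg hφc.mul_left)
      (fun x => ?_) (x := x₀) ?_
    · have := mul_nonneg (mul_nonneg hc.le (neg_nonneg.2 (hneg x).le)) (mollifier_nonneg 0 x)
      simp only [Pi.zero_apply]
      linarith
    · simp [hc.ne', (hneg x₀).ne, hx₀]
  rw [integral_neg] at h3
  linarith

end CooperativeSystem

/-! ### Translation between the operator and integrals of components. -/

section Operator

open Filter Topology

variable {n d : ℕ} {V : EuclideanSpace ℝ (Fin n) → Matrix (Fin d) (Fin d) ℝ}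

theorem memLp_component (f : VecL2 n d) (i : Fin d) : MemLp (fun x => f x i) 2 :=
  (EuclideanSpace.proj (𝕜 := ℝ) i).comp_memLp' (Lp.memLp f)

theorem inner_vecL2 (f g : VecL2 n d) : inner ℝ f g = ∑ i, ∫ x, f x i * g x i := by
  have h : ∫ x, ∑ i, f x i * g x i = ∑ i, ∫ x, f x i * g x i := integral_finsetSum _ fun i _ =>
    (memLp_component f i).integrable_mul (memLp_component g i)
  rw [L2.inner_def, ← h]
  refine integral_congr_ae (Eventually.of_forall fun x => ?_)
  simp [PiLp.inner_apply, mul_comm]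

theorem exists_mem_domain_of_test {L : VecL2 n d →ₗ.[ℝ] VecL2 n d}
    (hLV : IsSchrodingerOperator L V) {φ : Fin d → EuclideanSpace ℝ (Fin n) → ℝ}
    (hφ : ∀ i, ContDiff ℝ ∞ (φ i)) (hc : ∀ i, HasCompactSupport (φ i)) :
    ∃ a : L.domain, (∀ i, (fun x => (a : VecL2 n d) x i) =ᵐ[volume] φ i) ∧
      ∀ i, (fun x => (L a) x i) =ᵐ[volume] schrodingerComp V φ i := by
  set Φ : EuclideanSpace ℝ (Fin n) → EuclideanSpace ℝ (Fin d) :=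
    fun x => WithLp.toLp 2 fun i => φ i x with hΦ
  have hs : ContDiff ℝ ∞ Φ := contDiff_euclidean.2 hφ
  have hcs : HasCompactSupport Φ := by
    refine HasCompactSupport.of_support_subset_isCompact
      (isCompact_iUnion fun i => (hc i).isCompact) fun x hx => ?_
    by_contra hne
    refine hx ?_
    ext i
    exact image_eq_zero_of_notMem_tsupport (f := φ i) fun h => hne (Set.mem_iUnion.2 ⟨i, h⟩)
  obtain ⟨a, ha, hLa⟩ := hLV Φ hs hcs
  refine ⟨a, fun i => ?_, fun i => ?_⟩
  · filter_upwards [ha] with x hx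
    rw [hx]
  · filter_upwards [hLa] with x hx
    rw [hx]
    simp only [schrodingerExpr, schrodingerComp, PiLp.add_apply, PiLp.neg_apply,
      laplacian_apply_eq_lap hs x i]
    rfl

theorem inner_eq_sum_integral {f g : VecL2 n d} {p q : Fin d → EuclideanSpace ℝ (Fin n) → ℝ}
    (hf : ∀ i, (fun x => f x i) =ᵐ[volume] p i) (hg : ∀ i, (fun x => g x i) =ᵐ[volume] q i) :
    inner ℝ f g = ∑ i, ∫ x, p i x * q i x := by
  rw [inner_vecL2]
  refine Finset.sum_congr rfl fun i _ => integral_congr_ae ?_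
  filter_upwards [hf i, hg i] with x h1 h2
  rw [← h1, ← h2]

theorem IsSelfAdjoint.inner_map_eq {L : VecL2 n d →ₗ.[ℝ] VecL2 n d} (hL : IsSelfAdjoint L)
    (x y : L.domain) : inner ℝ (L x) (y : VecL2 n d) = inner ℝ (x : VecL2 n d) (L y) := by
  have h := LinearPMap.adjoint_isFormalAdjoint hL.dense_domain
  rw [LinearPMap.isSelfAdjoint_def.1 hL] at h
  exact h x y

end Operator

/-! ### Weak equation and quadratic form of the operator. -/

section Weak

open Filter Topology

variable {n d : ℕ} {V : EuclideanSpace ℝ (Fin n) → Matrix (Fin d) (Fin d) ℝ}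

/-- Elements of the domain of a self-adjoint Schrödinger operator satisfy the equation in the sense
of distributions. -/
theorem sum_integral_mul_schrodingerComp_eq {L : VecL2 n d →ₗ.[ℝ] VecL2 n d}
    (hLV : IsSchrodingerOperator L V) (hL : IsSelfAdjoint L) (ξ : L.domain)
    {φ : Fin d → EuclideanSpace ℝ (Fin n) → ℝ}
    (hφ : ∀ i, ContDiff ℝ ∞ (φ i)) (hc : ∀ i, HasCompactSupport (φ i)) :
    ∑ i, ∫ x, (ξ : VecL2 n d) x i * schrodingerComp V φ i x = ∑ i, ∫ x, (L ξ) x i * φ i x := by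
  obtain ⟨a, ha, hLa⟩ := exists_mem_domain_of_test hLV hφ hc
  have h := hL.inner_map_eq ξ a
  rw [inner_eq_sum_integral (fun i => EventuallyEq.rfl) ha,
    inner_eq_sum_integral (fun i => EventuallyEq.rfl) hLa] at h
  exact h.symm

/-- Expansion of `⟨L(ψ + tφ), ψ + tφ⟩`. Symmetry of `L` merges the cross terms with all derivatives
on `φ`, so that `ψ` may later tend to a mere `L²` function there. -/
theorem quadraticForm_add_smul_nonneg {L : VecL2 n d →ₗ.[ℝ] VecL2 n d}
    (hLV : IsSchrodingerOperator L V) (hL : IsSelfAdjoint L)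
    (hL_nonneg : ∀ u : L.domain, 0 ≤ inner ℝ (L u) (u : VecL2 n d))
    {φ ψ : Fin d → EuclideanSpace ℝ (Fin n) → ℝ}
    (hφ : ∀ i, ContDiff ℝ ∞ (φ i)) (hφc : ∀ i, HasCompactSupport (φ i))
    (hψ : ∀ i, ContDiff ℝ ∞ (ψ i)) (hψc : ∀ i, HasCompactSupport (ψ i)) (t : ℝ) :
    0 ≤ ∑ i, (∫ x, schrodingerComp V ψ i x * ψ i x) +
      2 * t * ∑ i, (∫ x, ψ i x * schrodingerComp V φ i x) +
      t ^ 2 * ∑ i, (∫ x, schrodingerComp V φ i x * φ i x) := by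
  obtain ⟨a, ha, hLa⟩ := exists_mem_domain_of_test hLV hφ hφc
  obtain ⟨b, hb, hLb⟩ := exists_mem_domain_of_test hLV hψ hψc
  have h := hL_nonneg (b + t • a)
  rw [LinearPMap.map_add, LinearPMap.map_smul] at h
  simp only [Submodule.coe_add, Submodule.coe_smul, inner_add_left, inner_add_right,
    real_inner_smul_left, real_inner_smul_right] at h
  rw [hL.inner_map_eq b a, ← real_inner_comm (L a : VecL2 n d) (b : VecL2 n d), inner_eq_sum_integral hLb hb,
    inner_eq_sum_integral hb hLa, inner_eq_sum_integral hLa ha] at h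
  linarith

end Weak

theorem mainTheorem3 (n d : ℕ)
    (V : EuclideanSpace ℝ (Fin n) → Matrix (Fin d) (Fin d) ℝ)
    (hV : ∀ i j, ContDiff ℝ ∞ (fun x => V x i j))
    (L : VecL2 n d →ₗ.[ℝ] VecL2 n d)
    (hLV : IsSchrodingerOperator L V)
    (hL : IsSelfAdjoint L)
    (hL_nonneg : ∀ u : L.domain, 0 ≤ inner ℝ (L u) (u : VecL2 n d))
    (hV_off : ∀ i j, i ≠ j → ∀ x, V x i j ≤ 0)
    (hV_irr : IrreducibleCoupling V)
    (ξ : L.domain) (η : VecL2 n d)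
    (hξη : L ξ = η)
    (hη : ∀ᵐ x, ∀ i, 0 ≤ η x i)
    (hξ : (ξ : VecL2 n d) ≠ 0) :
    StrictlyPos (ξ : VecL2 n d) ∨
      (η = 0 ∧ StrictlyPos (fun x => -(ξ : VecL2 n d) x)) := by
  have hVc : ∀ i j, Continuous fun x => V x i j := fun i j => (hV i j).continuous
  set u : Fin d → EuclideanSpace ℝ (Fin n) → ℝ := fun i x => (ξ : VecL2 n d) x i with hu
  have hum : ∀ i, MemLp (u i) 2 := memLp_component _
  have hul : ∀ i, LocallyIntegrable (u i) := fun i => (hum i).locallyIntegrable (by norm_num)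
  have hηm : ∀ i, MemLp (fun x => η x i) 2 := memLp_component η
  have hsingle : ∀ (i : Fin d) (φ : EuclideanSpace ℝ (Fin n) → ℝ), ContDiff ℝ ∞ φ →
      HasCompactSupport φ → (∀ j, ContDiff ℝ ∞ ((Pi.single i φ : Fin d → _) j)) ∧
        ∀ j, HasCompactSupport ((Pi.single i φ : Fin d → EuclideanSpace ℝ (Fin n) → ℝ) j) := by
    intro i φ hφ hc
    refine ⟨fun j => ?_, fun j => ?_⟩ <;> rcases eq_or_ne j i with rfl | hj
    · rwa [Pi.single_eq_same]
    · rw [Pi.single_eq_of_ne hj]; exact contDiff_const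
    · rwa [Pi.single_eq_same]
    · rw [Pi.single_eq_of_ne hj]; exact HasCompactSupport.zero
  have hweak : ∀ i, ∀ φ : EuclideanSpace ℝ (Fin n) → ℝ, ContDiff ℝ ∞ φ → HasCompactSupport φ →
      (∫ x, (∑ j, V x j i * u j x) * φ x) - ∫ x, u i x * lap φ x = ∫ x, η x i * φ x := by
    intro i φ hφ hc
    have h1 := sum_integral_mul_schrodingerComp_eq hLV hL ξ (hsingle i φ hφ hc).1
      (hsingle i φ hφ hc).2
    rw [hξη, Finset.sum_eq_single (f := fun j => ∫ x, η x j * _) i (fun j _ hj => by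
      rw [Pi.single_eq_of_ne hj]; simp) (by simp), Pi.single_eq_same] at h1
    rw [← sum_integral_mul_schrodingerComp_single hVc hul hφ hc i, h1]
  have hcoup : ∀ i, ∀ φ : EuclideanSpace ℝ (Fin n) → ℝ, ContDiff ℝ ∞ φ → HasCompactSupport φ →
      Integrable fun x => (∑ j, V x j i * u j x) * φ x := by
    intro i φ hφ hc
    simp only [Finset.sum_mul]
    refine integrable_finsetSum _ fun j _ => ((hul j).integrable_mul
      ((hVc j i).mul hφ.continuous) hc.mul_left).congr (Filter.Eventually.of_forall fun x => ?_)
    simp only [Pi.mul_apply]; ring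
  have hηi : ∀ i, ∀ φ : EuclideanSpace ℝ (Fin n) → ℝ, ContDiff ℝ ∞ φ → HasCompactSupport φ →
      Integrable fun x => η x i * φ x := fun i φ hφ hc =>
    ((hηm i).locallyIntegrable (by norm_num)).integrable_mul hφ.continuous hc
  have hlap : ∀ i, ∀ φ : EuclideanSpace ℝ (Fin n) → ℝ, ContDiff ℝ ∞ φ → HasCompactSupport φ →
      ∫ x, u i x * lap φ x = -∫ x, (η x i - ∑ j, V x j i * u j x) * φ x := by
    intro i φ hφ hc
    have h1 := hweak i φ hφ hc
    have h2 := integral_sub (hηi i φ hφ hc) (hcoup i φ hφ hc)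
    simp only [sub_mul, h2]
    linarith
  set v : Fin d → EuclideanSpace ℝ (Fin n) → ℝ := fun i x => max (-u i x) 0 with hv
  have hvm : ∀ i, MemLp (v i) 2 := fun i => (hum i).negPart_max
  have hv0 : ∀ i, 0 ≤ᵐ[volume] v i := fun i => Filter.Eventually.of_forall fun x => le_max_right _ _
  have hvweak : ∀ i, ∀ φ : EuclideanSpace ℝ (Fin n) → ℝ, ContDiff ℝ ∞ φ → HasCompactSupport φ →
      (∫ x, (∑ j, V x j i * v j x) * φ x) - ∫ x, v i x * lap φ x = 0 := by
    intro i φ hφ hc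
    have h1 := negPart_weak_solution hVc hV_off hum hηm hη hlap (hsingle i φ hφ hc).1
      (hsingle i φ hφ hc).2 fun t ψ hψ hψc => quadraticForm_add_smul_nonneg hLV hL hL_nonneg
        (hsingle i φ hφ hc).1 (hsingle i φ hφ hc).2 hψ hψc t
    rw [← sum_integral_mul_schrodingerComp_single hVc
      (fun i => (hvm i).locallyIntegrable (by norm_num)) hφ hc i, ← h1]
    exact Finset.sum_congr rfl fun j _ => integral_congr_ae
      (Filter.Eventually.of_forall fun x => mul_comm _ _)
  rcases cooperative_strong_maximum_principle hVc hV_off hV_irr hvm hv0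
    (fun i φ hφ hc _ => (hvweak i φ hφ hc).ge) with hzero | hpos
  · left
    have hu0 : ∀ i, 0 ≤ᵐ[volume] u i := fun i => by
      filter_upwards [hzero i] with x hx
      have : -u i x ≤ 0 := (le_max_left (-u i x) 0).trans hx.le
      simp only [Pi.zero_apply]
      linarith
    rcases cooperative_strong_maximum_principle hVc hV_off hV_irr hum hu0
      (fun i φ hφ hc hφ0 => by
        rw [hweak i φ hφ hc]
        refine integral_nonneg_of_ae ?_
        filter_upwards [hη] with x hx using mul_nonneg (hx i) (hφ0 x)) with huz | hup
    · refine absurd (Lp.ext ?_) hξ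
      filter_upwards [ae_all_iff.2 huz, Lp.coeFn_zero (EuclideanSpace ℝ (Fin d)) 2
        (volume : Measure (EuclideanSpace ℝ (Fin n)))] with x hx h0
      rw [h0]
      ext i
      exact hx i
    · exact hup
  · right
    have huv : ∀ i, ∀ᵐ x, u i x = -v i x := by
      intro i
      -- Lower bounds on compact sets give positivity a.e. by covering with unit balls; then `-u i`
      -- must be positive and equal to its positive part.
      have h1 : ∀ᵐ x, 0 < v i x := by
        rw [ae_iff]
        refine measure_null_of_locally_null _ fun x _ => ?_
        obtain ⟨c, hc, hcv⟩ := hpos i _ (isCompact_closedBall x 1)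
        have h2 := (ae_restrict_iff' Metric.isClosed_closedBall.measurableSet).1 hcv
        refine ⟨{y | ¬ 0 < v i y} ∩ Metric.closedBall x 1, Filter.inter_mem self_mem_nhdsWithin
          (mem_nhdsWithin_of_mem_nhds (Metric.closedBall_mem_nhds x one_pos)),
          measure_mono_null ?_ h2⟩
        rintro y ⟨hy1, hy2⟩ hy3
        exact hy1 (hc.trans_le (hy3 hy2))
      filter_upwards [h1] with x hx
      have : 0 ≤ -u i x := by
        by_contra h
        rw [hv] at hx
        simp only [max_eq_right (not_le.1 h).le, lt_self_iff_false] at hx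
      rw [hv]
      simp only [max_eq_left this, neg_neg]
    refine ⟨?_, fun i K hK => ?_⟩
    -- Since `u = -v` and `v` solves the homogeneous system, `η` integrates to zero against every
    -- test function.
    · have hη0 : ∀ i, ∀ᵐ x, η x i = 0 := by
        intro i
        refine ae_eq_zero_of_integral_contDiff_smul_eq_zero
          ((hηm i).locallyIntegrable (by norm_num)) fun φ hφ hc => ?_
        have h1 := hweak i φ hφ hc
        have h2 : ∫ x, (∑ j, V x j i * u j x) * φ x = -∫ x, (∑ j, V x j i * v j x) * φ x := by
          rw [← integral_neg]
          refine integral_congr_ae ?_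
          filter_upwards [ae_all_iff.2 huv] with x hx
          simp only [hx, mul_neg, Finset.sum_neg_distrib, neg_mul]
        have h3 : ∫ x, u i x * lap φ x = -∫ x, v i x * lap φ x := by
          rw [← integral_neg]
          refine integral_congr_ae ?_
          filter_upwards [huv i] with x hx
          rw [hx, neg_mul]
        have h4 := hvweak i φ hφ hc
        simp only [smul_eq_mul, mul_comm (φ _)]
        rw [← h1, h2, h3]
        linarith
      refine Lp.ext ?_
      filter_upwards [ae_all_iff.2 hη0, Lp.coeFn_zero (EuclideanSpace ℝ (Fin d)) 2
        (volume : Measure (EuclideanSpace ℝ (Fin n)))] with x hx h0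
      rw [h0]
      ext i
      exact hx i
    · obtain ⟨c, hc, hcv⟩ := hpos i K hK
      refine ⟨c, hc, ?_⟩
      filter_upwards [hcv, ae_restrict_of_ae (huv i)] with x hx hxu
      have : c ≤ -u i x := by rw [hxu, neg_neg]; exact hx
      exact this
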